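/- Let $m,n$ be integers with $2\le m\le n$, and let $A$ be an $m\times n$ array whose entries are independent random reals, uniform on $[0,1)$. For a set $q$ of positions, $\mathrm{RMQ}(A,q)$ is the position of the largest entry of $A$ in $q$ (equal entries are ordered lexicographically by their positions). A 4-sided query is a range $q=\{i_1,\dots,i_2\}\times\{j_1,\dots,j_2\}$ with $1\le i_1\le i_2\le m$ and $1\le j_1\le j_2\le n$; a 3-sided query is a range $q=\{1,\dots,i\}\times\{j_1,\dots,j_2\}$ with $1\le i\le m$ and $1\le j_1\le j_2\le n$. An encoding for a set $Q$ of queries assigns to every real $m\times n$ array a binary string from which alone, without access to the array, $\mathrm{RMQ}(\cdot,q)$ can be determined for every $q\in Q$. The expected effective entropy of $Q$ is the infimum, over all encodings for $Q$, of the expected length in bits of the string assigned to the random array $A$. Then the expected effective entropy of the 4-sided queries is $\Theta(nm)$ bits, and that of the 3-sided queries is $\Theta\bigl(n(\log_2 m)^2\bigr)$ bits. That is, there are absolute constants $c,C>0$ such that for all $2\le m\le n$ the former lies between $c\,nm$ and $C\,nm$, and the latter between $c\,n(\log_2 m)^2$ and $C\,n(\log_2 m)^2$. Both statements hold whether the infimum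 is taken over all encodings or only over prefix-free encodings (no code word is a proper prefix of another). -/

import Mathlib

open MeasureTheory
open scoped ENNReal

namespace RMQ2D

/-- A position (row, column) of an `m × n` array. -/
abbrev Pos (m n : ℕ) : Type := Fin m × Fin n

/-- An `m × n` array of real numbers. -/
abbrev Arr (m n : ℕ) : Type := Pos m n → ℝ

/-- The 4-sided query ranges `[i₁ … i₂] × [j₁ … j₂]`. -/
def fourSided (m n : ℕ) : Set (Finset (Pos m n)) :=
  {q | ∃ (i₁ i₂ : Fin m) (j₁ j₂ : Fin n), i₁ ≤ i₂ ∧ j₁ ≤ j₂ ∧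
    q = Finset.Icc i₁ i₂ ×ˢ Finset.Icc j₁ j₂}

/-- The 3-sided query ranges: the first `i` rows, intersected with a range
`[j₁ … j₂]` of columns. -/
def threeSided (m n : ℕ) : Set (Finset (Pos m n)) :=
  {q | ∃ (i : Fin m) (j₁ j₂ : Fin n), j₁ ≤ j₂ ∧
    q = Finset.Iic i ×ˢ Finset.Icc j₁ j₂}

/-- `p` is the position of the maximum of `A` in the range `q`; equal entries are ordered
lexicographically by their positions, so that there is exactly one such `p` for nonempty `q`. -/
def IsArgmax {m n : ℕ} (A : Arr m n) (q : Finset (Pos m n)) (p : Pos m n) : Prop :=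
  p ∈ q ∧ ∀ p' ∈ q, A p' < A p ∨ (A p' = A p ∧ toLex p' ≤ toLex p)

/-- `code` is an encoding of the `m × n` arrays for the set `Q` of query ranges: there is a
decoder that answers every query from the code word alone, without access to the array. -/
def IsEncoding {m n : ℕ} (Q : Set (Finset (Pos m n))) (code : Arr m n → List Bool) : Prop :=
  ∃ decode : List Bool → Finset (Pos m n) → Pos m n,
    ∀ A : Arr m n, ∀ q ∈ Q, IsArgmax A q (decode (code A) q)

/-- The two usual conventions on binary codes. -/
inductive CodeKind
  /-- Any binary strings may serve as code words. -/
  | arbitrary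
  /-- The code words have to be self-delimiting. -/
  | prefixFree

/-- `code` obeys the given convention. -/
def CodeKind.Admits {α : Type*} (kind : CodeKind) (code : α → List Bool) : Prop :=
  match kind with
  | .arbitrary => True
  | .prefixFree => ∀ a b : α, (code a).IsPrefix (code b) → code a = code b

/-- The law of an `m × n` array of independent random reals, uniform on `[0, 1)`. -/
noncomputable def randomArray (m n : ℕ) : Measure (Arr m n) :=
  Measure.pi fun _ : Pos m n => (volume : Measure ℝ).restrict (Set.Ico 0 1)

/-- The expected effective entropy of the queries `Q`: the least expected number of bits of
an encoding of a random array for `Q`, among the codes of the given kind. -/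
noncomputable def expectedEffectiveEntropy (kind : CodeKind) {m n : ℕ}
    (Q : Set (Finset (Pos m n))) : ℝ≥0∞ :=
  ⨅ (code : Arr m n → List Bool) (_ : IsEncoding Q code) (_ : kind.Admits code)
    (_ : Measurable fun A => (code A).length),
    ∫⁻ A, ((code A).length : ℝ≥0∞) ∂(randomArray m n)

end RMQ2D

namespace RMQ2D

/-! ### Random arrays -/

section RandomArray

variable {m n : ℕ}

/-! Everything rests on exchangeability: permuting entries inside a range leaves the law unchanged,
so the position of its maximum is uniform, even conditionally on any event invariant under such
permutations. `measureReal_biInter_maxIn_le` iterates this over suitably nested or disjoint ranges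
and yields product bounds.

Lower bounds: if every fixed table of answers is right with probability at most `2 ^ (-T)`, then
fewer than `2 ^ L` short words cannot cover much probability (`le_expectedEffectiveEntropy`). For
4-sided queries, disjoint adjacent pairs give about `m * n / 2` fair coins. For 3-sided queries,
take the first `2 ^ (k + 1)` entries of each column: with probability 1/2 the maximum is in the
upper half, and its position is then worth `k + 1` bits independent of the smaller ranges. At least
half of the total weight, of order `n * (log m) ^ 2`, is available with probability at least 1/2.

Upper bounds: answers are determined by which of a family of mostly rare events occur. Listing these
with `κ e` bits each costs `O(∑ κ e * P(E e) + ∑ 2 ^ (-κ e) + 1)` bits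
(`expectedEffectiveEntropy_le`). For 4-sided queries, the events are pairs `x`, `y` where `y` alone
beats `x` in their rectangle; with sides `h` and `w` the probability is `O(1 / (h * w) ^ 2)`, which
sums to `O(1)` per `x`. For 3-sided queries, each column has `O(log m)` expected prefix records and,
on average, `O(log m)` blocking pairs, at `O(log m)` bits each up to a summable term in the column
distance.

Counting short words covers arbitrary codes and the constructed code is prefix-free, so both
conventions are settled together. -/

instance isProbabilityMeasure_uniform :
    IsProbabilityMeasure ((volume : Measure ℝ).restrict (Set.Ico 0 1)) :=
  ⟨by simp⟩

instance isProbabilityMeasure_randomArray : IsProbabilityMeasure (randomArray m n) := by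
  unfold randomArray; infer_instance

/-- Permuting the positions of an array preserves the law of the random array. -/
lemma measurePreserving_comp_perm (σ : Equiv.Perm (Pos m n)) :
    MeasurePreserving (fun A : Arr m n => fun p => A (σ p)) (randomArray m n)
      (randomArray m n) := by
  have h := measurePreserving_piCongrLeft
    (fun _ : Pos m n => (volume : Measure ℝ).restrict (Set.Ico 0 1)) σ.symm
  change MeasurePreserving _ (Measure.pi _) (Measure.pi _)
  convert h using 1
  funext A p
  have := Equiv.piCongrLeft_apply_apply (P := fun _ : Pos m n => ℝ) σ.symm A (σ p)
  simp only [Equiv.symm_apply_apply] at this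
  simpa [MeasurableEquiv.coe_piCongrLeft] using this.symm

/-- Two entries of a random array are almost surely distinct. -/
lemma randomArray_eq_entries {p p' : Pos m n} (h : p ≠ p') :
    randomArray m n {A | A p = A p'} = 0 := by
  have hac : randomArray m n ≪ volume := by
    unfold randomArray
    rw [← Measure.restrict_pi_pi]
    exact Measure.absolutelyContinuous_of_le Measure.restrict_le_self
  refine hac ?_
  have hne : (LinearMap.proj (R := ℝ) (φ := fun _ : Pos m n => ℝ) p).eqLocus
      (LinearMap.proj p') ≠ ⊤ := by
    intro htop
    have : (Pi.single p 1 : Arr m n) ∈ (LinearMap.proj (R := ℝ) (φ := fun _ : Pos m n => ℝ)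
        p).eqLocus (LinearMap.proj p') := htop ▸ Submodule.mem_top
    simp [h.symm] at this
  exact Measure.addHaar_submodule volume _ hne

/-- The arrays having a maximal entry over `q` at a position of `U`. -/
def maxIn (q U : Finset (Pos m n)) : Set (Arr m n) :=
  {A | ∃ p ∈ U, ∀ p' ∈ q, A p' ≤ A p}

lemma measurableSet_maxIn (q U : Finset (Pos m n)) : MeasurableSet (maxIn q U) := by
  have : maxIn q U = ⋃ p ∈ U, ⋂ p' ∈ q, {A : Arr m n | A p' ≤ A p} := by
    ext A; simp [maxIn]
  rw [this]
  refine Finset.measurableSet_biUnion _ fun p _ => Finset.measurableSet_biInter _ fun p' _ => ?_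
  exact measurableSet_le (measurable_pi_apply _) (measurable_pi_apply _)

lemma comp_perm_mem_maxIn {q U : Finset (Pos m n)} {σ : Equiv.Perm (Pos m n)}
    (hq : ∀ x, σ x ∈ q ↔ x ∈ q) (hU : ∀ x, σ x ∈ U ↔ x ∈ U) {A : Arr m n} :
    (fun p => A (σ p)) ∈ maxIn q U ↔ A ∈ maxIn q U := by
  constructor
  · rintro ⟨p, hp, h⟩
    refine ⟨σ p, (hU p).2 hp, fun p' hp' => ?_⟩
    have := h (σ.symm p') ((hq _).1 (by simpa using hp'))
    simpa using this
  · rintro ⟨p, hp, h⟩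
    refine ⟨σ.symm p, (hU _).1 (by simpa using hp), fun p' hp' => ?_⟩
    simpa using h (σ p') ((hq _).2 hp')

/-- If `F` is insensitive to permutations of `q`, then conditionally on `F` the position of
the maximum over `q` is uniformly distributed. -/
lemma measureReal_inter_maxIn_le {q U : Finset (Pos m n)} (hUq : U ⊆ q) {F : Set (Arr m n)}
    (hF : MeasurableSet F)
    (hinv : ∀ p ∈ q, ∀ p' ∈ q, ∀ A : Arr m n, (fun x => A (Equiv.swap p p' x)) ∈ F ↔ A ∈ F)
    (hq : q.Nonempty) :
    (randomArray m n).real (F ∩ maxIn q U) ≤ (U.card / q.card : ℝ) * (randomArray m n).real F := by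
  set μ := randomArray m n
  have hmeas : ∀ V, MeasurableSet (F ∩ maxIn q V) := fun V => hF.inter (measurableSet_maxIn _ _)
  -- Swapping `p` and `p'` preserves the law and `F`, and exchanges the two events.
  have hconst : ∀ p ∈ q, ∀ p' ∈ q, μ.real (F ∩ maxIn q {p}) = μ.real (F ∩ maxIn q {p'}) := by
    intro p hp p' hp'
    have := (measurePreserving_comp_perm (Equiv.swap p p')).measureReal_preimage
      (hmeas {p}).nullMeasurableSet
    rw [← this]
    congr 1
    ext A
    simp only [Set.mem_preimage, Set.mem_inter_iff, hinv p hp p' hp']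
    refine and_congr_right fun _ => ?_
    constructor
    · rintro ⟨x, hx, h⟩
      obtain rfl := Finset.mem_singleton.1 hx
      refine ⟨p', by simp, fun y hy => ?_⟩
      have := h (Equiv.swap x p' y) (by
        by_cases h1 : y = x
        · simp [h1, hp']
        by_cases h2 : y = p'
        · simp [h2, hp]
        rwa [Equiv.swap_apply_of_ne_of_ne h1 h2])
      simpa using this
    · rintro ⟨x, hx, h⟩
      obtain rfl := Finset.mem_singleton.1 hx
      refine ⟨p, by simp, fun y hy => ?_⟩
      have := h (Equiv.swap p x y) (by
        by_cases h1 : y = p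
        · simp [h1, hp']
        by_cases h2 : y = x
        · simp [h2, hp]
        rwa [Equiv.swap_apply_of_ne_of_ne h1 h2])
      simpa using this
  obtain ⟨p₀, hp₀⟩ := hq
  set c := μ.real (F ∩ maxIn q {p₀})
  -- Ties have measure zero, so these equiprobable events are almost surely disjoint subsets of `F`.
  have hsum : (q.card : ℝ) * c ≤ μ.real F := by
    have h1 : ∑ p ∈ q, μ.real (F ∩ maxIn q {p}) = q.card * c := by
      rw [Finset.sum_congr rfl fun p hp => hconst p hp p₀ hp₀]
      simp [c]
    rw [← h1, ← measureReal_biUnion_finset₀]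
    · exact measureReal_mono (Set.iUnion₂_subset fun p _ => Set.inter_subset_left)
    · intro p hp p' hp' hne
      refine measure_mono_null ?_ (randomArray_eq_entries hne)
      rintro A ⟨⟨-, x, hx, h⟩, -, x', hx', h'⟩
      obtain rfl := Finset.mem_singleton.1 hx
      obtain rfl := Finset.mem_singleton.1 hx'
      exact le_antisymm (h' _ hp) (h _ hp')
    · exact fun p _ => (hmeas _).nullMeasurableSet
  have hU : μ.real (F ∩ maxIn q U) ≤ U.card * c := by
    have h1 : F ∩ maxIn q U ⊆ ⋃ p ∈ U, F ∩ maxIn q {p} := by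
      rintro A ⟨hA, p, hp, h⟩
      exact Set.mem_iUnion₂.2 ⟨p, hp, hA, p, by simp, h⟩
    refine (measureReal_mono h1 (measure_ne_top _ _)).trans ((measureReal_biUnion_finset_le _ _).trans ?_)
    rw [Finset.sum_congr rfl fun p hp => hconst p (hUq hp) p₀ hp₀]
    simp [c]
  have hqpos : (0 : ℝ) < q.card := by exact_mod_cast Finset.card_pos.2 ⟨p₀, hp₀⟩
  calc μ.real (F ∩ maxIn q U) ≤ U.card * c := hU
    _ = (U.card / q.card : ℝ) * (q.card * c) := by field_simp
    _ ≤ _ := by gcongr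

lemma measureReal_maxIn_le {q U : Finset (Pos m n)} (hUq : U ⊆ q) (hq : q.Nonempty) :
    (randomArray m n).real (maxIn q U) ≤ (U.card / q.card : ℝ) := by
  simpa using measureReal_inter_maxIn_le hUq MeasurableSet.univ (by simp) hq

/-- Peel off a range of least rank. Permuting entries inside it affects no other event: each other
range is disjoint from it, or contains it with the target `U t` either containing or missing it
entirely. Conditional uniformity then supplies one factor. -/
lemma measureReal_biInter_maxIn_le {ι : Type*} (S : Finset ι) (rank : ι → ℕ)
    (q U : ι → Finset (Pos m n)) (hU : ∀ s ∈ S, U s ⊆ q s) (hq : ∀ s ∈ S, (q s).Nonempty)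
    (hcompat : ∀ s ∈ S, ∀ t ∈ S, s ≠ t → rank s ≤ rank t → Disjoint (q s) (q t) ∨
      q s ⊆ q t ∧ (q s ⊆ U t ∨ Disjoint (q s) (U t))) :
    (randomArray m n).real (⋂ s ∈ S, maxIn (q s) (U s)) ≤
      ∏ s ∈ S, ((U s).card / (q s).card : ℝ) := by
  classical
  induction S using Finset.induction_on_min_value rank with
  | empty => simp
  | insert a s ha hmin ih =>
    rw [Finset.set_biInter_insert, Set.inter_comm, Finset.prod_insert ha]
    have ih' := ih (fun t ht => hU t (Finset.mem_insert_of_mem ht))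
      (fun t ht => hq t (Finset.mem_insert_of_mem ht))
      (fun t ht t' ht' => hcompat t (Finset.mem_insert_of_mem ht) t' (Finset.mem_insert_of_mem ht'))
    refine (measureReal_inter_maxIn_le (hU a (Finset.mem_insert_self _ _))
      (Finset.measurableSet_biInter _ fun t _ => measurableSet_maxIn _ _) ?_
      (hq a (Finset.mem_insert_self _ _))).trans (by gcongr)
    intro p hp p' hp' A
    simp only [Set.mem_iInter]
    refine forall₂_congr fun t ht => ?_
    have hta : a ≠ t := fun h => ha (h ▸ ht)
    have hout : ∀ V : Finset (Pos m n), p ∉ V → p' ∉ V → ∀ x, Equiv.swap p p' x ∈ V ↔ x ∈ V := by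
      intro V h1 h2 x
      by_cases hx : x = p
      · subst hx; simp [h1, h2]
      by_cases hx' : x = p'
      · subst hx'; simp [h1, h2]
      rw [Equiv.swap_apply_of_ne_of_ne hx hx']
    have hin : ∀ V : Finset (Pos m n), p ∈ V → p' ∈ V → ∀ x, Equiv.swap p p' x ∈ V ↔ x ∈ V := by
      intro V h1 h2 x
      by_cases hx : x = p
      · subst hx; simp [h1, h2]
      by_cases hx' : x = p'
      · subst hx'; simp [h1, h2]
      rw [Equiv.swap_apply_of_ne_of_ne hx hx']
    have hnot : ∀ V, Disjoint (q a) V → p ∉ V ∧ p' ∉ V := fun V h =>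
      ⟨Finset.disjoint_left.1 h hp, Finset.disjoint_left.1 h hp'⟩
    rcases hcompat a (Finset.mem_insert_self _ _) t (Finset.mem_insert_of_mem ht) hta (hmin t ht)
      with h | ⟨h1, h2 | h2⟩
    · have h' := hnot _ h
      have hUt := hU t (Finset.mem_insert_of_mem ht)
      exact comp_perm_mem_maxIn (hout _ h'.1 h'.2)
        (hout _ (fun hx => h'.1 (hUt hx)) (fun hx => h'.2 (hUt hx)))
    · exact comp_perm_mem_maxIn (hin _ (h1 hp) (h1 hp')) (hin _ (h2 hp) (h2 hp'))
    · exact comp_perm_mem_maxIn (hin _ (h1 hp) (h1 hp')) (hout _ (hnot _ h2).1 (hnot _ h2).2)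

end RandomArray

/-! ### The tie-breaking order -/

section Key

variable {m n : ℕ}

/-- Entries compare by value, equal entries by position. -/
def key (A : Arr m n) (p : Pos m n) : ℝ ×ₗ (Fin m ×ₗ Fin n) := toLex (A p, toLex p)

lemma key_injective (A : Arr m n) : Function.Injective (key A) := fun p p' h => by
  have := congrArg ofLex h
  simpa [key] using (Prod.ext_iff.1 this).2

lemma key_le_key_iff {A : Arr m n} {p p' : Pos m n} :
    key A p' ≤ key A p ↔ A p' < A p ∨ A p' = A p ∧ toLex p' ≤ toLex p := by
  simp [key, Prod.Lex.toLex_le_toLex]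

lemma le_of_key_le {A : Arr m n} {p p' : Pos m n} (h : key A p' ≤ key A p) : A p' ≤ A p := by
  rcases key_le_key_iff.1 h with h | h
  exacts [h.le, h.1.le]

lemma isArgmax_iff {A : Arr m n} {q : Finset (Pos m n)} {p : Pos m n} :
    IsArgmax A q p ↔ p ∈ q ∧ ∀ p' ∈ q, key A p' ≤ key A p := by
  simp only [IsArgmax, key_le_key_iff]

lemma exists_isArgmax (A : Arr m n) {q : Finset (Pos m n)} (hq : q.Nonempty) :
    ∃ p, IsArgmax A q p := by
  obtain ⟨p, hp, h⟩ := q.exists_max_image (key A) hq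
  exact ⟨p, isArgmax_iff.2 ⟨hp, h⟩⟩

lemma IsArgmax.unique {A : Arr m n} {q : Finset (Pos m n)} {p p' : Pos m n}
    (h : IsArgmax A q p) (h' : IsArgmax A q p') : p = p' := by
  rw [isArgmax_iff] at h h'
  exact key_injective A (le_antisymm (h'.2 _ h.1) (h.2 _ h'.1))

lemma IsArgmax.mem_maxIn {A : Arr m n} {q U : Finset (Pos m n)} {p : Pos m n}
    (h : IsArgmax A q p) (hp : p ∈ U) : A ∈ maxIn q U :=
  ⟨p, hp, fun p' hp' => le_of_key_le ((isArgmax_iff.1 h).2 p' hp')⟩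

lemma measurableSet_key_le (p p' : Pos m n) :
    MeasurableSet {A : Arr m n | key A p' ≤ key A p} := by
  simp only [key_le_key_iff, Set.ofPred_or, Set.ofPred_and]
  exact (measurableSet_lt (measurable_pi_apply p') (measurable_pi_apply p)).union
    ((measurableSet_eq_fun (measurable_pi_apply p') (measurable_pi_apply p)).inter (.const _))

end Key

/-! ### Lower bounds on the length of an encoding -/

lemma exists_finset_length_lt (L : ℕ) :
    ∃ W : Finset (List Bool), W.card ≤ 2 ^ L ∧ ∀ w : List Bool, w.length < L → w ∈ W := by
  classical
  refine ⟨(Finset.range L).biUnion fun k => Finset.univ.image (List.ofFn : (Fin k → Bool) → _),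
    ?_, fun w hw => ?_⟩
  · refine Finset.card_biUnion_le.trans ?_
    calc ∑ k ∈ Finset.range L, (Finset.univ.image (List.ofFn : (Fin k → Bool) → _)).card
        ≤ ∑ k ∈ Finset.range L, 2 ^ k := Finset.sum_le_sum fun k _ =>
          Finset.card_image_le.trans (by simp)
      _ ≤ 2 ^ L := by
          rw [Nat.geomSum_eq le_rfl]; simp
  · simp only [Finset.mem_biUnion, Finset.mem_range, Finset.mem_image, Finset.mem_univ, true_and]
    exact ⟨w.length, hw, w.get, List.ofFn_get w⟩

section Lower

variable {m n : ℕ} {Q : Set (Finset (Pos m n))} {code : Arr m n → List Bool}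

/-- The arrays for which `a` answers all queries correctly. -/
def answeredBy (Q : Set (Finset (Pos m n))) (a : Finset (Pos m n) → Pos m n) : Set (Arr m n) :=
  {A | ∀ q ∈ Q, IsArgmax A q (a q)}

/-- Each short word fixes, through the decoder, one table of answers; a union bound over these words
applies on `G`, and the complement of `G` is given away. -/
lemma measureReal_length_lt_le (hcode : IsEncoding Q code) {G : Set (Arr m n)} {ε : ℝ}
    (h : ∀ a, (randomArray m n).real (answeredBy Q a ∩ G) ≤ ε) (L : ℕ) :
    (randomArray m n).real {A | (code A).length < L} ≤
      (randomArray m n).real Gᶜ + 2 ^ L * ε := by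
  obtain ⟨decode, hdec⟩ := hcode
  obtain ⟨W, hW, hmem⟩ := exists_finset_length_lt L
  have hsub : {A | (code A).length < L} ⊆
      Gᶜ ∪ ⋃ w ∈ W, (answeredBy Q (decode w) ∩ G) := by
    intro A hA
    by_cases hG : A ∈ G
    · exact .inr (Set.mem_iUnion₂.2 ⟨code A, hmem _ hA, hdec A, hG⟩)
    · exact .inl hG
  have hε : 0 ≤ ε := measureReal_nonneg.trans (h (decode []))
  refine (measureReal_mono hsub (measure_ne_top _ _)).trans ((measureReal_union_le _ _).trans ?_)
  gcongr
  refine (measureReal_biUnion_finset_le _ _).trans ((Finset.sum_le_card_nsmul _ _ _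
    fun w _ => h (decode w)).trans ?_)
  rw [nsmul_eq_mul]
  gcongr
  exact_mod_cast hW

lemma mul_le_lintegral_length (hmeas : Measurable fun A => (code A).length) {L : ℕ} {ε : ℝ}
    (h : (randomArray m n).real {A | (code A).length < L} ≤ 1 - ε) :
    ENNReal.ofReal (L * ε) ≤ ∫⁻ A, ((code A).length : ℝ≥0∞) ∂(randomArray m n) := by
  have hm : Measurable fun A => ((code A).length : ℝ≥0∞) := measurable_from_top.comp hmeas
  refine le_trans ?_ (mul_meas_ge_le_lintegral hm L)
  have hset : {A | (L : ℝ≥0∞) ≤ ((code A).length : ℝ≥0∞)} = {A | (code A).length < L}ᶜ := by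
    ext A; simp
  have hms : MeasurableSet {A | (code A).length < L} := hmeas (measurableSet_Iio (a := L))
  rw [hset, ENNReal.ofReal_mul (by positivity), ENNReal.ofReal_natCast]
  gcongr
  rw [← ofReal_measureReal (by finiteness), probReal_compl_eq_one_sub hms]
  exact ENNReal.ofReal_le_ofReal (by linarith)

/-- If no table of answers is correct with large probability, then encodings are long. -/
lemma le_expectedEffectiveEntropy (kind : CodeKind) {G : Set (Arr m n)} {T : ℕ}
    (hG : (randomArray m n).real Gᶜ ≤ 1 / 2)
    (h : ∀ a, (randomArray m n).real (answeredBy Q a ∩ G) ≤ (1 / 2) ^ T)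
    (h0 : ∀ a, (randomArray m n).real (answeredBy Q a) ≤ 1 / 2) :
    ENNReal.ofReal (T / 8) ≤ expectedEffectiveEntropy kind Q := by
  refine le_iInf fun code => le_iInf fun hcode => le_iInf fun _ => le_iInf fun hmeas => ?_
  rcases le_total T 4 with hT | hT
  -- For small `T` it suffices that the empty word is used with probability at most 1/2.
  · have h1 : (randomArray m n).real {A | (code A).length < 1} ≤ 1 - 1 / 2 := by
      obtain ⟨decode, hdec⟩ := hcode
      refine (measureReal_mono (fun A hA => ?_) (measure_ne_top _ _)).trans
        ((h0 (decode [])).trans (by norm_num))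
      have : code A = [] := by simpa using hA
      exact this ▸ hdec A
    refine le_trans (ENNReal.ofReal_le_ofReal ?_) (mul_le_lintegral_length hmeas h1)
    have : (T : ℝ) ≤ 4 := by exact_mod_cast hT
    push_cast; linarith
  -- With `L = T - 2`, short words account for at most 1/4 beyond the 1/2 lost outside `G`. The
  -- remaining 1/4 gives `L / 4 ≥ T / 8`.
  · obtain ⟨L, rfl⟩ := Nat.exists_eq_add_of_le' (show 2 ≤ T by omega)
    have h1 := measureReal_length_lt_le hcode h L
    have h2 : (2 : ℝ) ^ L * (1 / 2) ^ (L + 2) = 1 / 4 := by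
      rw [pow_add, ← mul_assoc, ← mul_pow]; norm_num
    rw [h2] at h1
    refine le_trans (ENNReal.ofReal_le_ofReal ?_)
      (mul_le_lintegral_length (L := L) (ε := 1 / 4) hmeas (by linarith))
    have : (2 : ℝ) ≤ L := by exact_mod_cast (show 2 ≤ L by omega)
    push_cast; linarith

end Lower

/-! ### Encodings by sparse sets of events -/

lemma replicate_append_prefix {a b : ℕ} {u v : List Bool}
    (h : List.replicate a true ++ false :: u <+: List.replicate b true ++ false :: v) :
    a = b ∧ u <+: v := by
  induction a generalizing b with
  | zero =>
    cases b with
    | zero => simpa using h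
    | succ b => simp [List.replicate_succ] at h
  | succ a ih =>
    cases b with
    | zero => simp [List.replicate_succ] at h
    | succ b =>
      have := ih (b := b) (by simpa [List.replicate_succ] using h)
      exact ⟨by rw [this.1], this.2⟩

/-- A finite set of objects having at most `2 ^ (k + L)` members of size `k` for each `k` has a
prefix-free code with words of length `2 * k + L + 1`. -/
lemma exists_prefixFree_code {D : Type*} [Fintype D] (s : D → ℕ) (L : ℕ)
    (h : ∀ k, Fintype.card {d // s d = k} ≤ 2 ^ (k + L)) :
    ∃ word : D → List Bool, (∀ d d', word d <+: word d' → d = d') ∧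
      ∀ d, (word d).length = 2 * s d + L + 1 := by
  have hg : ∀ k, Nonempty ({d // s d = k} ↪ (Fin (k + L) → Bool)) := fun k =>
    Function.Embedding.nonempty_of_card_le (by simpa using h k)
  have g := fun k => Classical.choice (hg k)
  -- The size in unary, closed by `false`, tells how long the index block that follows is.
  refine ⟨fun d => List.replicate (s d) true ++ false :: List.ofFn (g (s d) ⟨d, rfl⟩), ?_, ?_⟩
  · have key : ∀ k k' d (hd : s d = k) d' (hd' : s d' = k'),
        List.replicate k true ++ false :: List.ofFn (g k ⟨d, hd⟩) <+:
          List.replicate k' true ++ false :: List.ofFn (g k' ⟨d', hd'⟩) → d = d' := by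
      intro k k' d hd d' hd' hpre
      obtain ⟨rfl, hpre⟩ := replicate_append_prefix hpre
      have h1 := List.ofFn_injective (hpre.eq_of_length (by simp))
      exact congrArg Subtype.val ((g k).injective h1)
    exact fun d d' => key _ _ d rfl d' rfl
  · intro d
    simp
    ring

/-- The generating function of subsets by weight, evaluated at 1/2, is `∏ (1 + 2 ^ (-κ e))`. It is
at most `exp (L / 2) ≤ 2 ^ L`, and the subsets of weight `k` contribute `2 ^ (-k)` each. -/
lemma card_weight_le {I : Type*} [Fintype I] [DecidableEq I] (κ : I → ℕ) {L : ℕ}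
    (hL : 2 * ∑ e, (1 / 2 : ℝ) ^ κ e ≤ L) (k : ℕ) :
    Fintype.card {d : Finset I // ∑ e ∈ d, κ e = k} ≤ 2 ^ (k + L) := by
  have hprod : ∏ e : I, (1 + (1 / 2 : ℝ) ^ κ e) ≤ 2 ^ L := by
    calc ∏ e : I, (1 + (1 / 2 : ℝ) ^ κ e) ≤ ∏ e : I, Real.exp ((1 / 2 : ℝ) ^ κ e) :=
          Finset.prod_le_prod (fun _ _ => by positivity) fun e _ => by
            rw [add_comm]; exact Real.add_one_le_exp _
      _ = Real.exp (∑ e, (1 / 2 : ℝ) ^ κ e) := (Real.exp_sum _ _).symm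
      _ ≤ Real.exp (L * Real.log 2) := by
          apply Real.exp_le_exp.2
          have := Real.log_two_gt_d9
          have hL0 : (0 : ℝ) ≤ L := by positivity
          nlinarith
      _ = 2 ^ L := by rw [mul_comm, Real.exp_mul, Real.exp_log two_pos, Real.rpow_natCast]
  rw [Finset.prod_one_add, Finset.powerset_univ] at hprod
  have h1 : (Fintype.card {d : Finset I // ∑ e ∈ d, κ e = k} : ℝ) * (1 / 2) ^ k ≤ 2 ^ L := by
    refine le_trans ?_ hprod
    rw [Fintype.card_subtype, ← nsmul_eq_mul]
    refine le_trans (Finset.card_nsmul_le_sum _ (fun d : Finset I => ∏ e ∈ d, (1 / 2 : ℝ) ^ κ e) _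
      fun d hd => ?_) (Finset.sum_le_sum_of_subset_of_nonneg (Finset.filter_subset _ _)
        fun _ _ _ => by positivity)
    rw [Finset.prod_pow_eq_pow_sum, (Finset.mem_filter.1 hd).2]
  have h2 : (Fintype.card {d : Finset I // ∑ e ∈ d, κ e = k} : ℝ) ≤ 2 ^ (k + L) := by
    calc _ = (Fintype.card {d : Finset I // ∑ e ∈ d, κ e = k} : ℝ) * (1 / 2) ^ k * 2 ^ k := by
          rw [mul_assoc, ← mul_pow]; norm_num
      _ ≤ 2 ^ L * 2 ^ k := by gcongr
      _ = 2 ^ (k + L) := by ring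
  exact_mod_cast h2

/-- If the answers to the queries are determined by which of the events `E e` occur, then it
suffices to list the events that occur, at a cost of `κ e` bits each. -/
lemma expectedEffectiveEntropy_le {m n : ℕ} [Nonempty (Pos m n)] (kind : CodeKind)
    {Q : Set (Finset (Pos m n))} (hQ : ∀ q ∈ Q, q.Nonempty) {I : Type*} [Fintype I]
    (E : I → Set (Arr m n)) (hE : ∀ e, MeasurableSet (E e)) (κ : I → ℕ)
    (hdet : ∀ A B, (∀ e, A ∈ E e ↔ B ∈ E e) → ∀ q ∈ Q, ∀ x, IsArgmax A q x → IsArgmax B q x) :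
    expectedEffectiveEntropy kind Q ≤ ENNReal.ofReal
      (2 * ∑ e, κ e * (randomArray m n).real (E e) + 2 * ∑ e, (1 / 2 : ℝ) ^ κ e + 2) := by
  classical
  set S : ℝ := ∑ e, (1 / 2 : ℝ) ^ κ e
  have hS : 0 ≤ S := Finset.sum_nonneg fun _ _ => by positivity
  set L := ⌈2 * S⌉₊
  obtain ⟨word, hword, hlen⟩ := exists_prefixFree_code (fun d : Finset I => ∑ e ∈ d, κ e) L
    (card_weight_le κ (Nat.le_ceil _))
  set ev : Arr m n → Finset I := fun A => Finset.univ.filter fun e => A ∈ E e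
  have hev : ∀ A B, ev A = ev B → ∀ e, A ∈ E e ↔ B ∈ E e := fun A B h e => by
    have := Finset.ext_iff.1 h e
    simpa [ev] using this
  set code : Arr m n → List Bool := fun A => word (ev A)
  have hsum : ∀ A, ((∑ e ∈ ev A, κ e : ℕ) : ℝ≥0∞) =
      ∑ e, (E e).indicator (fun _ => (κ e : ℝ≥0∞)) A := fun A => by
    simp [ev, Finset.sum_filter, Set.indicator_apply]
  have hmeas : Measurable fun A => (code A).length := by
    simp only [code, hlen]
    have : Measurable fun A => ∑ e ∈ ev A, κ e := by
      have : (fun A => ∑ e ∈ ev A, κ e) = fun A => ∑ e, (E e).indicator (fun _ => κ e) A := by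
        funext A; simp [ev, Finset.sum_filter, Set.indicator_apply]
      rw [this]
      exact Finset.measurable_fun_sum _ fun e _ => measurable_const.indicator (hE e)
    fun_prop
  have henc : IsEncoding Q code := by
    -- The decoder answers for any array with this code word: equal words mean equal event sets,
    -- hence equal answers. The default value serves only when no such array and answer exist.
    refine ⟨fun w q => if h : ∃ A x, code A = w ∧ IsArgmax A q x then h.choose_spec.choose else
      Classical.arbitrary _, fun A q hq => ?_⟩
    obtain ⟨x, hx⟩ := exists_isArgmax A (hQ q hq)
    have h : ∃ B y, code B = code A ∧ IsArgmax B q y := ⟨A, x, rfl, hx⟩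
    simp only [dif_pos h]
    have hspec := h.choose_spec.choose_spec
    refine hdet _ _ (hev _ _ (hword _ _ ?_)) q hq _ hspec.2
    have := hspec.1
    simp only [code] at this
    rw [this]
  have hadm : kind.Admits code := by
    cases kind with
    | arbitrary => trivial
    | prefixFree => exact fun A B h => congrArg word (hword _ _ h)
  unfold expectedEffectiveEntropy
  refine iInf_le_of_le code <| iInf_le_of_le henc <| iInf_le_of_le hadm <|
    iInf_le_of_le hmeas ?_
  have hint : ∫⁻ A, ((code A).length : ℝ≥0∞) ∂(randomArray m n) =
      2 * ∑ e, κ e * randomArray m n (E e) + L + 1 := by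
    simp only [code, hlen]
    push_cast
    simp only [← Nat.cast_sum, hsum]
    have hmI : ∀ e ∈ Finset.univ, Measurable ((E e).indicator fun _ => (κ e : ℝ≥0∞)) :=
      fun e _ => measurable_const.indicator (hE e)
    rw [lintegral_add_right _ measurable_const, lintegral_add_right _ measurable_const,
      lintegral_const_mul _ (Finset.measurable_fun_sum _ hmI), lintegral_finsetSum _ hmI]
    simp [lintegral_indicator_const (hE _)]
  rw [hint]
  have hcast : 2 * ∑ e, (κ e : ℝ≥0∞) * randomArray m n (E e) + L + 1 =
      ENNReal.ofReal (2 * ∑ e, κ e * (randomArray m n).real (E e) + L + 1) := by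
    rw [ENNReal.ofReal_add (by positivity) zero_le_one, ENNReal.ofReal_add (by positivity)
      (by positivity), ENNReal.ofReal_mul zero_le_two, ENNReal.ofReal_sum_of_nonneg
      fun _ _ => by positivity]
    simp [ENNReal.ofReal_mul, ofReal_measureReal]
  rw [hcast]
  refine ENNReal.ofReal_le_ofReal ?_
  have := Nat.ceil_lt_add_one (show 0 ≤ 2 * S by positivity)
  linarith

/-! ### The lower bound for 4-sided queries -/

section LowerFour

variable {m n : ℕ}

/-- The two horizontally adjacent positions in columns `2 * j` and `2 * j + 1` of row `i`. -/
def pairRange (s : Fin m × Fin (n / 2)) : Finset (Pos m n) :=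
  Finset.Icc s.1 s.1 ×ˢ Finset.Icc ⟨2 * s.2, by omega⟩ ⟨2 * s.2 + 1, by omega⟩

lemma mem_pairRange {s : Fin m × Fin (n / 2)} {x : Pos m n} :
    x ∈ pairRange s ↔ x.1 = s.1 ∧ (x.2 : ℕ) / 2 = s.2 := by
  simp only [pairRange, Finset.Icc_self, Finset.mem_product, Finset.mem_singleton, Finset.mem_Icc,
    Fin.le_def]
  refine and_congr_right fun _ => ?_
  omega

lemma card_pairRange (s : Fin m × Fin (n / 2)) : (pairRange (n := n) s).card = 2 := by
  simp [pairRange]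
  omega

/-- The pairs are disjoint, so each independently agrees with the table with probability 1/2. -/
lemma measureReal_answeredBy_fourSided_le (a : Finset (Pos m n) → Pos m n) :
    (randomArray m n).real (answeredBy (fourSided m n) a) ≤ (1 / 2) ^ (m * (n / 2)) := by
  by_cases hex : (answeredBy (fourSided m n) a).Nonempty
  swap
  · rw [Set.not_nonempty_iff_eq_empty.1 hex]; simp
  have hq : ∀ s, pairRange s ∈ fourSided m n := fun s =>
    ⟨s.1, s.1, _, _, le_rfl, by simp [Fin.le_def], rfl⟩
  obtain ⟨A₀, hA₀⟩ := hex
  have hmem : ∀ s : Fin m × Fin (n / 2), a (pairRange s) ∈ pairRange s := fun s =>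
    (hA₀ _ (hq s)).1
  have hsub : answeredBy (fourSided m n) a ⊆
      ⋂ s ∈ (Finset.univ : Finset (Fin m × Fin (n / 2))),
        maxIn (pairRange s) {a (pairRange s)} := by
    intro A hA
    exact Set.mem_iInter₂.2 fun s _ => (hA _ (hq s)).mem_maxIn (by simp)
  refine (measureReal_mono hsub (measure_ne_top _ _)).trans
    ((measureReal_biInter_maxIn_le _ (fun _ => 0) _ _ (fun s _ => ?_) (fun s _ => ⟨_, hmem s⟩)
      fun s _ t _ hst _ => .inl ?_).trans ?_)
  · simpa using hmem s
  · refine Finset.disjoint_left.2 fun x hx hx' => hst ?_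
    rw [mem_pairRange] at hx hx'
    exact Prod.ext (hx.1.symm.trans hx'.1) (Fin.ext (hx.2.symm.trans hx'.2))
  · simp [card_pairRange]

lemma le_expectedEffectiveEntropy_fourSided (kind : CodeKind) (hm : 2 ≤ m) (hn : 2 ≤ n) :
    ENNReal.ofReal (1 / 24 * (n * m)) ≤ expectedEffectiveEntropy kind (fourSided m n) := by
  have hT : 1 ≤ m * (n / 2) := Nat.mul_pos (by omega) (by omega)
  refine le_trans (ENNReal.ofReal_le_ofReal ?_) (le_expectedEffectiveEntropy kind
    (G := Set.univ) (T := m * (n / 2)) (by simp)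
    (fun a => by simpa using measureReal_answeredBy_fourSided_le a)
    fun a => (measureReal_answeredBy_fourSided_le a).trans ?_)
  -- The factor 3 absorbs the floor, whence `1 / 24 = 1 / 8 * 1 / 3`.
  · have : (n : ℝ) ≤ 3 * (n / 2 : ℕ) := by exact_mod_cast (show n ≤ 3 * (n / 2) by omega)
    have hm0 : (0 : ℝ) ≤ m := by positivity
    push_cast
    nlinarith
  · calc ((1 : ℝ) / 2) ^ (m * (n / 2)) ≤ (1 / 2) ^ 1 :=
        pow_le_pow_of_le_one (by norm_num) (by norm_num) hT
      _ = 1 / 2 := by norm_num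

end LowerFour

/-! ### The lower bound for 3-sided queries -/

section LowerThree

variable {m n : ℕ}

/-- The rows with index in `[s, t)`, in column `j`. -/
def colRange (m : ℕ) (j : Fin n) (s t : ℕ) : Finset (Pos m n) :=
  (Finset.univ.filter fun i : Fin m => s ≤ (i : ℕ) ∧ (i : ℕ) < t) ×ˢ {j}

lemma mem_colRange {j : Fin n} {s t : ℕ} {x : Pos m n} :
    x ∈ colRange m j s t ↔ (s ≤ (x.1 : ℕ) ∧ (x.1 : ℕ) < t) ∧ x.2 = j := by
  simp only [colRange, Finset.mem_product, Finset.mem_filter, Finset.mem_univ, true_and,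
    Finset.mem_singleton]

lemma card_colRange (j : Fin n) {s t : ℕ} (ht : t ≤ m) : (colRange m j s t).card = t - s := by
  rw [colRange, Finset.card_product, Finset.card_singleton, mul_one]
  rw [← Nat.card_Ico, ← Finset.card_map Fin.valEmbedding]
  congr 1
  ext x
  simp only [Finset.mem_map, Finset.mem_filter, Finset.mem_univ, true_and, Fin.valEmbedding_apply,
    Finset.mem_Ico]
  constructor
  · rintro ⟨i, hi, rfl⟩; exact hi
  · intro h; exact ⟨⟨x, by omega⟩, h, rfl⟩

lemma colRange_mem_threeSided (j : Fin n) {t : ℕ} (h0 : 0 < t) (ht : t ≤ m) :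
    colRange m j 0 t ∈ threeSided m n := by
  refine ⟨⟨t - 1, by omega⟩, j, j, le_rfl, ?_⟩
  ext x
  simp only [mem_colRange, Finset.mem_product, Finset.mem_Iic, Finset.Icc_self,
    Finset.mem_singleton, Fin.le_def]
  refine and_congr_left fun _ => ?_
  omega

variable {K : ℕ}

/-- The first `2 ^ (k + 1)` entries of column `j`. -/
def dyadic (m : ℕ) (s : Fin n × Fin K) : Finset (Pos m n) := colRange m s.1 0 (2 ^ (s.2 + 1 : ℕ))

/-- The lower (`b = false`) or upper (`b = true`) half of the rows of `dyadic m s`. -/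
def dyadicHalf (m : ℕ) (s : Fin n × Fin K) (b : Bool) : Finset (Pos m n) :=
  if b then colRange m s.1 (2 ^ (s.2 : ℕ)) (2 ^ (s.2 + 1 : ℕ))
  else colRange m s.1 0 (2 ^ (s.2 : ℕ))

lemma two_pow_succ_le (hK : 2 ^ K ≤ m) (k : Fin K) : 2 ^ (k + 1 : ℕ) ≤ m :=
  (Nat.pow_le_pow_right two_pos k.2).trans hK

lemma two_pow_lt_succ (k : ℕ) : 2 ^ k < 2 ^ (k + 1) := Nat.pow_lt_pow_right one_lt_two k.lt_succ_self

lemma card_dyadic (hK : 2 ^ K ≤ m) (s : Fin n × Fin K) :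
    (dyadic m s).card = 2 ^ (s.2 + 1 : ℕ) := by
  rw [dyadic, card_colRange _ (two_pow_succ_le hK _), Nat.sub_zero]

lemma card_dyadicHalf (hK : 2 ^ K ≤ m) (s : Fin n × Fin K) (b : Bool) :
    (dyadicHalf m s b).card = 2 ^ (s.2 : ℕ) := by
  have h1 := two_pow_succ_le hK s.2
  have h2 := two_pow_lt_succ s.2
  cases b
  · simp [dyadicHalf, card_colRange _ (h2.le.trans h1)]
  · simp only [dyadicHalf, if_true, card_colRange _ h1]
    rw [pow_succ]; omega

lemma dyadicHalf_subset (s : Fin n × Fin K) (b : Bool) : dyadicHalf m s b ⊆ dyadic m s := by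
  intro x hx
  have h2 := two_pow_lt_succ s.2
  cases b <;> simp only [dyadicHalf, dyadic, mem_colRange, if_true, if_false, Bool.false_eq_true]
    at hx ⊢ <;> exact ⟨by omega, hx.2⟩

lemma dyadic_nonempty (hK : 2 ^ K ≤ m) (s : Fin n × Fin K) : (dyadic m s).Nonempty :=
  Finset.card_pos.1 (by rw [card_dyadic hK]; positivity)

lemma dyadic_mem_threeSided (hK : 2 ^ K ≤ m) (s : Fin n × Fin K) :
    dyadic m s ∈ threeSided m n :=
  colRange_mem_threeSided _ (by positivity) (two_pow_succ_le hK _)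

lemma mem_dyadicHalf_or {s : Fin n × Fin K} {x : Pos m n} (hx : x ∈ dyadic m s) :
    x ∈ dyadicHalf m s true ∨ x ∈ dyadicHalf m s false := by
  simp only [dyadicHalf, dyadic, mem_colRange, if_true, if_false, Bool.false_eq_true] at hx ⊢
  rcases lt_or_ge (x.1 : ℕ) (2 ^ (s.2 : ℕ)) with h | h
  · exact .inr ⟨⟨by omega, h⟩, hx.2⟩
  · exact .inl ⟨⟨h, hx.1.2⟩, hx.2⟩

/-- Different columns are disjoint; within a column a shorter prefix fits in the lower half of a
longer one. This is the nesting that the product bound needs. -/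
lemma dyadic_compat {s t : Fin n × Fin K} (hst : s ≠ t) (hle : (s.2 : ℕ) ≤ t.2) :
    Disjoint (dyadic m s) (dyadic m t) ∨ dyadic m s ⊆ dyadicHalf m t false := by
  by_cases h : s.1 = t.1
  · right
    have hlt : (s.2 : ℕ) + 1 ≤ t.2 := by
      rcases hle.lt_or_eq with h' | h'
      · exact h'
      · exact absurd (Prod.ext h (Fin.ext h')) hst
    have := Nat.pow_le_pow_right two_pos hlt
    intro x hx
    simp only [dyadicHalf, dyadic, mem_colRange, if_false, Bool.false_eq_true] at hx ⊢
    exact ⟨⟨by omega, by omega⟩, hx.2.trans h⟩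
  · left
    refine Finset.disjoint_left.2 fun x hx hx' => h ?_
    simp only [dyadic, mem_colRange] at hx hx'
    exact hx.2.symm.trans hx'.2

lemma disjoint_dyadicHalf (s : Fin n × Fin K) :
    Disjoint (dyadicHalf m s false) (dyadicHalf m s true) := by
  refine Finset.disjoint_left.2 fun x hx hx' => ?_
  simp only [dyadicHalf, mem_colRange, if_true, if_false, Bool.false_eq_true] at hx hx'
  omega

/-- Whether the maximum over each `dyadic m s` lies in its upper half is decided by independent
fair coins. -/
lemma measureReal_biInter_dyadicHalf_le (hK : 2 ^ K ≤ m) (b : Fin n × Fin K → Bool) :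
    (randomArray m n).real (⋂ s ∈ (Finset.univ : Finset (Fin n × Fin K)),
      maxIn (dyadic m s) (dyadicHalf m s (b s))) ≤ (1 / 2) ^ (n * K) := by
  refine (measureReal_biInter_maxIn_le _ (fun s => (s.2 : ℕ)) _ _
    (fun s _ => dyadicHalf_subset s _) (fun s _ => dyadic_nonempty hK s) ?_).trans ?_
  · intro s _ t _ hst hle
    rcases dyadic_compat (m := m) hst hle with h | h
    · exact .inl h
    · refine .inr ⟨h.trans (dyadicHalf_subset _ _), ?_⟩
      cases b t
      · exact .inl h
      · exact .inr ((disjoint_dyadicHalf t).mono_left h)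
  · have : ∀ s : Fin n × Fin K, ((dyadicHalf m s (b s)).card / (dyadic m s).card : ℝ) = 1 / 2 := by
      intro s
      rw [card_dyadicHalf hK, card_dyadic hK]
      push_cast
      rw [pow_succ]; field_simp
    simp [this]

/-- The number of bits of information in the positions of the maxima over those `dyadic m s`
with maximum in the upper half. -/
def bitCount (b : Fin n × Fin K → Bool) : ℕ := ∑ s, if b s then (s.2 + 1 : ℕ) else 0

lemma bitCount_add_bitCount_not (b : Fin n × Fin K → Bool) :
    bitCount b + bitCount (fun s => !b s) = ∑ s : Fin n × Fin K, (s.2 + 1 : ℕ) := by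
  rw [bitCount, bitCount, ← Finset.sum_add_distrib]
  exact Finset.sum_congr rfl fun s _ => by cases b s <;> simp

/-- Flipping all coins maps patterns below half of the total weight injectively to patterns not
below it. -/
lemma card_bitCount_lt_le : 2 * (Finset.univ.filter fun b : Fin n × Fin K → Bool =>
    2 * bitCount b < ∑ s : Fin n × Fin K, (s.2 + 1 : ℕ)).card ≤ 2 ^ (n * K) := by
  set W := ∑ s : Fin n × Fin K, (s.2 + 1 : ℕ)
  set S := Finset.univ.filter fun b : Fin n × Fin K → Bool => 2 * bitCount b < W
  have h1 : S.card ≤ Sᶜ.card := by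
    refine Finset.card_le_card_of_injOn (fun b s => !b s) (fun b hb => ?_) fun b _ b' _ h => ?_
    · have hb' : 2 * bitCount b < W := by simpa [S] using hb
      have := bitCount_add_bitCount_not b
      simp only [S, Finset.coe_compl, Set.mem_compl_iff, Finset.mem_coe, Finset.mem_filter,
        Finset.mem_univ, true_and, not_lt]
      omega
    · funext s
      simpa using congrFun h s
  have h2 := Finset.card_add_card_compl S
  simp only [Fintype.card_fun, Fintype.card_bool, Fintype.card_prod, Fintype.card_fin] at h2
  omega

/-- The arrays for which many maxima over `dyadic m s` lie in the upper half. -/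
def manyUpper (m n K : ℕ) : Set (Arr m n) :=
  {A | ∃ b : Fin n × Fin K → Bool, (∑ s : Fin n × Fin K, (s.2 + 1 : ℕ)) ≤ 2 * bitCount b ∧
    ∀ s p, IsArgmax A (dyadic m s) p → p ∈ dyadicHalf m s (b s)}

/-- At most half of the `2 ^ (n * K)` coin patterns are light, and each has probability at most `2 ^
(-(n * K))`. -/
lemma measureReal_compl_manyUpper_le (hK : 2 ^ K ≤ m) :
    (randomArray m n).real (manyUpper m n K)ᶜ ≤ 1 / 2 := by
  classical
  set W := ∑ s : Fin n × Fin K, (s.2 + 1 : ℕ)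
  set S := Finset.univ.filter fun b : Fin n × Fin K → Bool => 2 * bitCount b < W
  have hsub : (manyUpper m n K)ᶜ ⊆ ⋃ b ∈ S, ⋂ s ∈ (Finset.univ : Finset (Fin n × Fin K)),
      maxIn (dyadic m s) (dyadicHalf m s (b s)) := by
    intro A hA
    have hb : ∀ s : Fin n × Fin K, ∃ b, ∃ p, IsArgmax A (dyadic m s) p ∧
        p ∈ dyadicHalf m s b := by
      intro s
      obtain ⟨p, hp⟩ := exists_isArgmax A (dyadic_nonempty hK s)
      rcases mem_dyadicHalf_or (isArgmax_iff.1 hp).1 with h | h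
      exacts [⟨_, p, hp, h⟩, ⟨_, p, hp, h⟩]
    choose b p hp hpb using hb
    refine Set.mem_iUnion₂.2 ⟨b, ?_, Set.mem_iInter₂.2 fun s _ => (hp s).mem_maxIn (hpb s)⟩
    by_contra hbS
    refine hA ⟨b, by simpa [S] using hbS, fun s p' hp' => ?_⟩
    rw [hp'.unique (hp s)]
    exact hpb s
  refine (measureReal_mono hsub (measure_ne_top _ _)).trans
    ((measureReal_biUnion_finset_le _ _).trans ((Finset.sum_le_card_nsmul _ _ _
      fun b _ => measureReal_biInter_dyadicHalf_le hK b).trans ?_))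
  have h : 2 * (S.card : ℝ) ≤ 2 ^ (n * K) := by exact_mod_cast card_bitCount_lt_le
  rw [nsmul_eq_mul]
  calc (S.card : ℝ) * (1 / 2) ^ (n * K) ≤ (2 ^ (n * K) / 2) * (1 / 2) ^ (n * K) := by
        gcongr; linarith
    _ = (2 * (1 / 2)) ^ (n * K) / 2 := by rw [mul_pow]; ring
    _ = 1 / 2 := by norm_num

/-- The table itself dictates the pattern `b`, so one array `A₀` suffices to read it off. Only
ranges answered in their upper half are kept: there the answer lies outside all shorter prefixes, so
the product bound applies and gives `2 ^ (-bitCount b)`. -/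
lemma measureReal_answeredBy_inter_manyUpper_le (hK : 2 ^ K ≤ m)
    (a : Finset (Pos m n) → Pos m n) {T : ℕ}
    (hT : 2 * T ≤ (∑ s : Fin n × Fin K, (s.2 + 1 : ℕ)) + 1) :
    (randomArray m n).real (answeredBy (threeSided m n) a ∩ manyUpper m n K) ≤ (1 / 2) ^ T := by
  classical
  by_cases hex : (answeredBy (threeSided m n) a ∩ manyUpper m n K).Nonempty
  swap
  · rw [Set.not_nonempty_iff_eq_empty.1 hex]; simp
  obtain ⟨A₀, hA₀, b, hb, hbA⟩ := hex
  have hq := dyadic_mem_threeSided (n := n) hK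
  have hmem : ∀ s : Fin n × Fin K, a (dyadic m s) ∈ dyadicHalf m s (b s) := fun s =>
    hbA s _ (hA₀ _ (hq s))
  have hsub : answeredBy (threeSided m n) a ∩ manyUpper m n K ⊆
      ⋂ s ∈ Finset.univ.filter fun s : Fin n × Fin K => b s = true,
        maxIn (dyadic m s) {a (dyadic m s)} := by
    rintro A ⟨hA, -⟩
    exact Set.mem_iInter₂.2 fun s _ => (hA _ (hq s)).mem_maxIn (by simp)
  refine (measureReal_mono hsub (measure_ne_top _ _)).trans
    ((measureReal_biInter_maxIn_le _ (fun s => (s.2 : ℕ)) _ _ (fun s _ => ?_)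
      (fun s _ => dyadic_nonempty hK s) ?_).trans ?_)
  · simpa using dyadicHalf_subset s _ (hmem s)
  · intro s _ t ht hst hle
    rcases dyadic_compat (m := m) hst hle with h | h
    · exact .inl h
    · refine .inr ⟨h.trans (dyadicHalf_subset _ _), .inr ?_⟩
      have htu := hmem t
      rw [(Finset.mem_filter.1 ht).2] at htu
      exact ((disjoint_dyadicHalf t).mono_left h).mono_right (by simpa using htu)
  · have hcard : ∀ s : Fin n × Fin K,
        ((({a (dyadic m s)} : Finset (Pos m n)).card : ℝ) / (dyadic m s).card) =
          (1 / 2) ^ (s.2 + 1 : ℕ) := by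
      intro s
      rw [card_dyadic hK]; simp
    simp only [hcard]
    rw [Finset.prod_pow_eq_pow_sum, Finset.sum_filter]
    refine pow_le_pow_of_le_one (by norm_num) (by norm_num) ?_
    change T ≤ bitCount b
    omega

lemma measureReal_answeredBy_threeSided_le (hm : 2 ≤ m) (hn : 0 < n)
    (a : Finset (Pos m n) → Pos m n) :
    (randomArray m n).real (answeredBy (threeSided m n) a) ≤ 1 / 2 := by
  set q := colRange m (⟨0, hn⟩ : Fin n) 0 2
  have hq : q ∈ threeSided m n := colRange_mem_threeSided _ two_pos hm
  have hcard : q.card = 2 := card_colRange _ hm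
  by_cases hex : (answeredBy (threeSided m n) a).Nonempty
  swap
  · rw [Set.not_nonempty_iff_eq_empty.1 hex]; simp
  obtain ⟨A₀, hA₀⟩ := hex
  have ha : a q ∈ q := (hA₀ q hq).1
  refine (measureReal_mono (s₂ := maxIn q {a q}) (fun A hA => (hA q hq).mem_maxIn (by simp))
    (measure_ne_top _ _)).trans ((measureReal_maxIn_le (by simpa using ha) ⟨_, ha⟩).trans ?_)
  simp [hcard]

lemma le_expectedEffectiveEntropy_threeSided (kind : CodeKind) (hm : 2 ≤ m) (hn : 0 < n) :
    ENNReal.ofReal (1 / 64 * (n * Real.logb 2 m ^ 2)) ≤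
      expectedEffectiveEntropy kind (threeSided m n) := by
  set K := Nat.log 2 m
  have hK : 2 ^ K ≤ m := Nat.pow_log_le_self 2 (by omega)
  have hK1 : 1 ≤ K := Nat.log_pos one_lt_two hm
  set W := ∑ s : Fin n × Fin K, (s.2 + 1 : ℕ)
  have hW : 2 * W = n * (K * (K + 1)) := by
    have h1 : W = n * ∑ k ∈ Finset.range K, (k + 1) := by
      simp only [W, Fintype.sum_prod_type, Finset.sum_const, Finset.card_univ, Fintype.card_fin,
        smul_eq_mul]
      rw [Fin.sum_univ_eq_sum_range (fun k => k + 1)]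
    have h2 := Finset.sum_range_id_mul_two (K + 1)
    rw [Finset.sum_range_succ', add_zero] at h2
    rw [h1, mul_left_comm, mul_comm 2, h2, Nat.add_sub_cancel, mul_comm (K + 1)]
  refine le_trans (ENNReal.ofReal_le_ofReal ?_) (le_expectedEffectiveEntropy kind
    (G := manyUpper m n K) (T := (W + 1) / 2) (measureReal_compl_manyUpper_le hK)
    (fun a => measureReal_answeredBy_inter_manyUpper_le hK a (by omega))
    fun a => measureReal_answeredBy_threeSided_le hm hn a)
  have hlog : Real.logb 2 m ≤ K + 1 := by
    rw [Real.logb_le_iff_le_rpow one_lt_two (by positivity)]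
    have := (Nat.lt_pow_succ_log_self one_lt_two m).le
    exact_mod_cast this
  have hlog0 : 0 ≤ Real.logb 2 m := Real.logb_nonneg one_lt_two (by exact_mod_cast (by omega))
  have h1 : (W : ℝ) ≤ 2 * ((W + 1) / 2 : ℕ) := by
    exact_mod_cast (show W ≤ 2 * ((W + 1) / 2) by omega)
  have h2 : 2 * (W : ℝ) = n * (K * (K + 1)) := by exact_mod_cast hW
  have h3 : (1 : ℝ) ≤ K := by exact_mod_cast hK1
  -- Since `K ≥ 1`, `(K + 1) ^ 2 ≤ 2 * K * (K + 1)`. With `T ≥ W / 2` and `W = n * K * (K + 1) / 2`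
  -- this produces `1 / 64`.
  have h4 : Real.logb 2 m ^ 2 ≤ 2 * (K * (K + 1)) := by nlinarith
  have h5 : (n : ℝ) * Real.logb 2 m ^ 2 ≤ n * (2 * (K * (K + 1))) := by gcongr
  linarith

end LowerThree

/-! ### Sums over distances -/

/-- The number of indices from `j` to `j'`. -/
def span {n : ℕ} (j j' : Fin n) : ℕ := (Finset.uIcc j j').card

lemma clog_two_sq_le (h : ℕ) : Nat.clog 2 h ^ 2 ≤ 4 * h := by
  have hpow : ∀ k : ℕ, (k + 1) ^ 2 ≤ 4 * 2 ^ k := by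
    intro k
    induction k with
    | zero => norm_num
    | succ k ih =>
      rcases k with _ | _ | k
      · norm_num
      · norm_num
      · have h1 : (k + 1 + 1 + 1 + 1) ^ 2 ≤ 2 * (k + 1 + 1 + 1) ^ 2 := by nlinarith [Nat.zero_le k]
        exact h1.trans ((Nat.mul_le_mul_left 2 ih).trans_eq (by ring))
  rcases Nat.eq_zero_or_pos (Nat.clog 2 h) with h0 | h0
  · simp [h0]
  · obtain ⟨k, hk⟩ := Nat.exists_eq_add_of_le' h0
    have h1 : 2 ^ k < h := by
      rw [← Nat.lt_clog_iff_pow_lt one_lt_two]; omega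
    rw [hk]
    exact (hpow k).trans (by omega)

/-- The crude bound `clog h ≤ 2 * √h` allows comparison with `h ^ (-3 / 2)`. -/
lemma summable_clog_div_sq : Summable fun h : ℕ => (Nat.clog 2 h : ℝ) / (h : ℝ) ^ 2 := by
  refine Summable.of_nonneg_of_le (fun _ => by positivity) (fun h => ?_)
    ((Real.summable_nat_rpow_inv.2 (show (1 : ℝ) < 3 / 2 by norm_num)).mul_left 2)
  rcases Nat.eq_zero_or_pos h with rfl | hpos
  · simp
  have hh : (0 : ℝ) < h := by exact_mod_cast hpos
  have h1 : (Nat.clog 2 h : ℝ) ≤ 2 * (h : ℝ) ^ (1 / 2 : ℝ) := by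
    rw [← Real.sqrt_eq_rpow]
    refine (pow_le_pow_iff_left₀ (by positivity) (by positivity) two_ne_zero).1 ?_
    rw [mul_pow, Real.sq_sqrt hh.le]
    have := clog_two_sq_le h
    norm_num
    exact_mod_cast this
  have h2 : ((h : ℝ) ^ (3 / 2 : ℝ))⁻¹ = (h : ℝ) ^ (1 / 2 : ℝ) / h ^ 2 := by
    rw [← Real.rpow_natCast, ← Real.rpow_sub hh, ← Real.rpow_neg hh.le]
    norm_num
  rw [h2, ← mul_div_assoc]
  gcongr

lemma summable_one_div_sq : Summable fun h : ℕ => 1 / (h : ℝ) ^ 2 :=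
  Real.summable_one_div_nat_pow.2 one_lt_two

/-- On either side of `j` the distance determines `j'`, so each side costs at most the full series.
-/
lemma sum_span_le {n : ℕ} {φ : ℕ → ℝ} (hφ : Summable φ) (h0 : ∀ k, 0 ≤ φ k) (j : Fin n) :
    ∑ j' : Fin n, φ (span j j') ≤ 2 * ∑' k, φ k := by
  have hinj : ∀ P : Fin n → Prop, [DecidablePred P] →
      (∀ a b, P a → P b → span j a = span j b → a = b) →
      ∑ j' ∈ Finset.univ.filter P, φ (span j j') ≤ ∑' k, φ k := by
    intro P _ hP
    rw [← Finset.sum_image (f := φ) (g := fun j' => span j j')]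
    · exact hφ.sum_le_tsum _ fun k _ => h0 k
    · intro a ha b hb hab
      exact hP a b (by simpa using ha) (by simpa using hb) hab
  rw [← Finset.sum_filter_add_sum_filter_not Finset.univ (fun j' => j ≤ j'), two_mul]
  refine add_le_add (hinj _ fun a b ha hb hab => ?_) (hinj _ fun a b ha hb hab => ?_) <;>
  · simp only [span, Fin.card_uIcc, Fin.le_def] at *
    apply Fin.ext
    omega

/-- The sum of `1 / h ^ 2` over all `h`. -/
noncomputable def sumInvSq : ℝ := ∑' h : ℕ, 1 / (h : ℝ) ^ 2

/-- The sum of `⌈log₂ h⌉ / h ^ 2` over all `h`. -/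
noncomputable def sumClogInvSq : ℝ := ∑' h : ℕ, (Nat.clog 2 h : ℝ) / (h : ℝ) ^ 2

lemma sumInvSq_nonneg : 0 ≤ sumInvSq := tsum_nonneg fun _ => by positivity

lemma sumClogInvSq_nonneg : 0 ≤ sumClogInvSq := tsum_nonneg fun _ => by positivity

lemma sum_inv_span_sq_le {n : ℕ} (j : Fin n) :
    ∑ j' : Fin n, 1 / (span j j' : ℝ) ^ 2 ≤ 2 * sumInvSq :=
  sum_span_le summable_one_div_sq (fun _ => by positivity) j

lemma sum_clog_span_le {n : ℕ} (j : Fin n) :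
    ∑ j' : Fin n, (Nat.clog 2 (span j j') : ℝ) / (span j j' : ℝ) ^ 2 ≤
      2 * sumClogInvSq :=
  sum_span_le summable_clog_div_sq (fun _ => by positivity) j

lemma half_pow_clog_le {h : ℕ} (h0 : 0 < h) : (1 / 2 : ℝ) ^ Nat.clog 2 h ≤ 1 / h := by
  rw [one_div_pow]
  have : (h : ℝ) ≤ 2 ^ Nat.clog 2 h := by exact_mod_cast Nat.le_pow_clog one_lt_two h
  gcongr

lemma half_pow_two_mul_clog_le {h w : ℕ} (h0 : 0 < h) (w0 : 0 < w) :
    (1 / 2 : ℝ) ^ (2 * Nat.clog 2 h + 2 * Nat.clog 2 w) ≤ 1 / (h : ℝ) ^ 2 * (1 / (w : ℝ) ^ 2) := by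
  rw [pow_add, pow_mul', pow_mul', ← one_div_pow, ← one_div_pow]
  gcongr
  exacts [half_pow_clog_le h0, half_pow_clog_le w0]

lemma span_pos {n : ℕ} (j j' : Fin n) : 0 < span j j' :=
  Finset.card_pos.2 ⟨j, Finset.left_mem_uIcc⟩

lemma one_div_pred_mul_le {a : ℕ} (ha : 2 ≤ a) :
    1 / ((a - 1 : ℕ) : ℝ) * (1 / a) ≤ 2 * (1 / (a : ℝ) ^ 2) := by
  obtain ⟨b, rfl⟩ := Nat.exists_eq_add_of_le' ha
  rw [show b + 2 - 1 = b + 1 from rfl]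
  push_cast
  have hb : (0 : ℝ) ≤ b := by positivity
  rw [one_div_mul_one_div, mul_one_div, div_le_div_iff₀ (by positivity) (by positivity)]
  nlinarith

lemma sum_pos_mul {m n : ℕ} (f : Fin m → ℝ) (g : Fin n → ℝ) :
    ∑ y : Pos m n, f y.1 * g y.2 = (∑ i, f i) * ∑ j, g j := by
  rw [Fintype.sum_prod_type, Finset.sum_mul_sum]

/-! ### Joint probabilities of maxima over nested ranges -/

section Blocking

variable {m n : ℕ}

lemma measurableSet_forall_key_le (S : Finset (Pos m n)) (p : Pos m n) :
    MeasurableSet {A : Arr m n | ∀ z ∈ S, key A z ≤ key A p} := by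
  have : {A : Arr m n | ∀ z ∈ S, key A z ≤ key A p} =
      ⋂ z ∈ S, {A : Arr m n | key A z ≤ key A p} := by ext; simp
  rw [this]
  exact Finset.measurableSet_biInter _ fun z _ => measurableSet_key_le p z

/-- The probability that the maximum over `R` is attained at `y` and the maximum over a subset
`R'` not containing `y` is attained at `x`. -/
lemma measureReal_maxIn_inter_maxIn_le {R R' : Finset (Pos m n)} {x y : Pos m n} (hy : y ∈ R)
    (hR : R' ⊆ R) (hyR : y ∉ R') (hx : x ∈ R') :
    (randomArray m n).real (maxIn R {y} ∩ maxIn R' {x}) ≤ 1 / (R'.card : ℝ) * (1 / R.card) := by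
  classical
  -- The smaller range `R'` gets rank 0; it misses the target `{y}` of `R`.
  have := measureReal_biInter_maxIn_le (m := m) (n := n) (Finset.univ : Finset Bool)
    (fun b => if b then 1 else 0)
    (fun b => if b then R else R') (fun b => if b then {y} else {x})
    (by simp [hy, hx]) (by rintro (_ | _) - <;> exact ⟨_, by simpa using ‹_›⟩)
    (by simp [hR, hyR])
  have hset : maxIn R {y} ∩ maxIn R' {x} ⊆ ⋂ b ∈ (Finset.univ : Finset Bool),
      maxIn (if b then R else R') (if b then {y} else {x}) := by
    rintro A ⟨h1, h2⟩
    simp [h1, h2]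
  refine (measureReal_mono hset (measure_ne_top _ _)).trans (this.trans_eq ?_)
  simp [mul_comm]

end Blocking

/-! ### The upper bound for 4-sided queries -/

section UpperFour

variable {m n : ℕ}

/-- `y` is the first obstacle to `x` being a maximum: within the rectangle spanned by `x` and
`y`, it is the only position with an entry above that at `x`. -/
def Blocks (A : Arr m n) (x y : Pos m n) : Prop :=
  key A x < key A y ∧ ∀ z ∈ (Finset.uIcc x y).erase y, key A z ≤ key A x

lemma measurableSet_blocks (x y : Pos m n) : MeasurableSet {A | Blocks A x y} := by
  simp only [Blocks, Set.ofPred_and, ← not_le]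
  exact (measurableSet_key_le _ _).compl.inter (measurableSet_forall_key_le _ _)

/-- If `x` is beaten in `q`, a `y` beating it with the smallest spanned rectangle blocks it: a
second such entry inside would span a strictly smaller rectangle. The rectangle stays within `q`. -/
lemma isArgmax_fourSided_iff {A : Arr m n} {q : Finset (Pos m n)} (hq : q ∈ fourSided m n)
    {x : Pos m n} : IsArgmax A q x ↔ x ∈ q ∧ ∀ y ∈ q, ¬ Blocks A x y := by
  rw [isArgmax_iff]
  refine and_congr_right fun hx => ⟨fun h y hy hb => (h y hy).not_gt hb.1, fun h => ?_⟩
  by_contra! hex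
  obtain ⟨y₀, hy₀, hlt₀⟩ := hex
  obtain ⟨y, hy, hmin⟩ := (q.filter fun y => key A x < key A y).exists_min_image
    (fun y => (Finset.uIcc x y).card) ⟨y₀, by simp [hy₀, hlt₀]⟩
  rw [Finset.mem_filter] at hy
  refine h y hy.1 ⟨hy.2, fun z hz => ?_⟩
  by_contra! hlt
  rw [Finset.mem_erase] at hz
  have hsub : Finset.uIcc x y ⊆ q := by
    obtain ⟨i₁, i₂, j₁, j₂, -, -, rfl⟩ := hq
    rw [Finset.Icc_product_Icc] at hx hy ⊢
    exact Finset.uIcc_subset_Icc hx hy.1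
  have hsub' : Finset.uIcc x z ⊆ Finset.uIcc x y :=
    Finset.uIcc_subset_uIcc Finset.left_mem_uIcc hz.2
  have heq := Finset.eq_of_subset_of_card_le hsub'
    (hmin z (Finset.mem_filter.2 ⟨hsub hz.2, hlt⟩))
  exact hz.1 (Finset.uIcc_injective_left x heq)

/-- With `a` cells in the rectangle, `y` tops all of them and `x` tops the other `a - 1`:
probability at most `1 / (a * (a - 1)) ≤ 2 / a ^ 2`. -/
lemma measureReal_blocks_le (x y : Pos m n) :
    (randomArray m n).real {A | Blocks A x y} ≤
      2 * (1 / (span x.1 y.1 : ℝ) ^ 2 * (1 / (span x.2 y.2 : ℝ) ^ 2)) := by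
  by_cases hxy : x = y
  · subst hxy
    have : {A : Arr m n | Blocks A x x} = ∅ := by ext; simp [Blocks]
    rw [this, measureReal_empty]; positivity
  have hy : y ∈ Finset.uIcc x y := Finset.right_mem_uIcc
  have hx : x ∈ (Finset.uIcc x y).erase y := Finset.mem_erase.2 ⟨hxy, Finset.left_mem_uIcc⟩
  have hsub : {A : Arr m n | Blocks A x y} ⊆
      maxIn (Finset.uIcc x y) {y} ∩ maxIn ((Finset.uIcc x y).erase y) {x} := by
    rintro A ⟨h1, h2⟩
    refine ⟨⟨y, by simp, fun z hz => ?_⟩, x, by simp, fun z hz => le_of_key_le (h2 z hz)⟩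
    by_cases hzy : z = y
    · rw [hzy]
    · exact le_of_key_le ((h2 z (Finset.mem_erase.2 ⟨hzy, hz⟩)).trans h1.le)
  refine (measureReal_mono hsub (measure_ne_top _ _)).trans
    ((measureReal_maxIn_inter_maxIn_le hy (Finset.erase_subset _ _) (by simp) hx).trans ?_)
  have h2 : 0 < ((Finset.uIcc x y).erase y).card := Finset.card_pos.2 ⟨x, hx⟩
  rw [Finset.card_erase_of_mem hy] at h2 ⊢
  have hcard : (Finset.uIcc x y).card = span x.1 y.1 * span x.2 y.2 := Finset.card_uIcc_prod x y
  refine (one_div_pred_mul_le (a := (Finset.uIcc x y).card) (by omega)).trans_eq ?_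
  rw [hcard]; push_cast; rw [mul_pow, one_div_mul_one_div]

lemma expectedEffectiveEntropy_fourSided_le (kind : CodeKind) [Nonempty (Pos m n)] :
    expectedEffectiveEntropy kind (fourSided m n) ≤ ENNReal.ofReal
      ((64 * (sumInvSq * sumClogInvSq) + 8 * sumInvSq ^ 2 + 2) * (n * m)) := by
  set F := sumInvSq
  set G := sumClogInvSq
  have hF : 0 ≤ F := sumInvSq_nonneg
  have hG : 0 ≤ G := sumClogInvSq_nonneg
  have hQ : ∀ q ∈ fourSided m n, q.Nonempty := by
    rintro q ⟨i₁, i₂, j₁, j₂, hi, hj, rfl⟩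
    exact ⟨(i₁, j₁), by simp [hi, hj]⟩
  -- The costs are chosen so that `2 ^ (-κ)` is at most the inverse square of the rectangle's area,
  -- matching the probability up to a constant.
  refine (expectedEffectiveEntropy_le kind hQ (I := Pos m n × Pos m n)
    (fun e => {A | Blocks A e.1 e.2}) (fun e => measurableSet_blocks _ _)
    (fun e => 2 * Nat.clog 2 (span e.1.1 e.2.1) + 2 * Nat.clog 2 (span e.1.2 e.2.2)) ?_).trans
    (ENNReal.ofReal_le_ofReal ?_)
  · intro A B hAB q hq x
    rw [isArgmax_fourSided_iff hq, isArgmax_fourSided_iff hq]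
    exact fun hx => ⟨hx.1, fun y hy hb => hx.2 y hy ((hAB (x, y)).2 hb)⟩
  rw [Fintype.sum_prod_type' (fun x y : Pos m n =>
      ((2 * Nat.clog 2 (span x.1 y.1) + 2 * Nat.clog 2 (span x.2 y.2) : ℕ) : ℝ) *
        (randomArray m n).real {A | Blocks A x y}),
    Fintype.sum_prod_type' (fun x y : Pos m n =>
      (1 / 2 : ℝ) ^ (2 * Nat.clog 2 (span x.1 y.1) + 2 * Nat.clog 2 (span x.2 y.2)))]
  have hsum : ∀ (x : Pos m n) (f g : ℕ → ℝ),
      ∑ y : Pos m n, f (span x.1 y.1) * g (span x.2 y.2) =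
        (∑ i, f (span x.1 i)) * ∑ j, g (span x.2 j) := fun x f g =>
    sum_pos_mul (fun i => f (span x.1 i)) fun j => g (span x.2 j)
  have halg : ∀ (a b : ℕ) (s t : ℝ), ((2 * a + 2 * b : ℕ) : ℝ) * (2 * (1 / s ^ 2 * (1 / t ^ 2))) =
      4 * (a / s ^ 2 * (1 / t ^ 2)) + 4 * (1 / s ^ 2 * (b / t ^ 2)) := by
    intro a b s t
    push_cast
    ring
  have h1 : ∀ x : Pos m n, ∑ y : Pos m n,
      ((2 * Nat.clog 2 (span x.1 y.1) + 2 * Nat.clog 2 (span x.2 y.2) : ℕ) : ℝ) *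
      (randomArray m n).real {A | Blocks A x y} ≤ 32 * (F * G) := by
    intro x
    calc _ ≤ ∑ y : Pos m n, (4 * ((Nat.clog 2 (span x.1 y.1) : ℝ) / (span x.1 y.1 : ℝ) ^ 2 *
            (1 / (span x.2 y.2 : ℝ) ^ 2)) + 4 * (1 / (span x.1 y.1 : ℝ) ^ 2 *
            ((Nat.clog 2 (span x.2 y.2) : ℝ) / (span x.2 y.2 : ℝ) ^ 2))) := by
          refine Finset.sum_le_sum fun y _ => ?_
          exact (mul_le_mul_of_nonneg_left (measureReal_blocks_le x y)
            (by positivity)).trans_eq (halg _ _ _ _)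
      _ = 4 * ((∑ i, (Nat.clog 2 (span x.1 i) : ℝ) / (span x.1 i : ℝ) ^ 2) *
            ∑ j, 1 / (span x.2 j : ℝ) ^ 2) +
          4 * ((∑ i, 1 / (span x.1 i : ℝ) ^ 2) *
            ∑ j, (Nat.clog 2 (span x.2 j) : ℝ) / (span x.2 j : ℝ) ^ 2) := by
          rw [Finset.sum_add_distrib, ← Finset.mul_sum, ← Finset.mul_sum,
            hsum x (fun k => (Nat.clog 2 k : ℝ) / (k : ℝ) ^ 2) fun k => 1 / (k : ℝ) ^ 2,
            hsum x (fun k => 1 / (k : ℝ) ^ 2) fun k => (Nat.clog 2 k : ℝ) / (k : ℝ) ^ 2]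
      _ ≤ 4 * ((2 * G) * (2 * F)) + 4 * ((2 * F) * (2 * G)) := by
          gcongr
          exacts [sum_clog_span_le _, sum_inv_span_sq_le _, sum_inv_span_sq_le _,
            sum_clog_span_le _]
      _ = 32 * (F * G) := by ring
  have h2 : ∀ x : Pos m n,
      ∑ y : Pos m n, (1 / 2 : ℝ) ^ (2 * Nat.clog 2 (span x.1 y.1) +
        2 * Nat.clog 2 (span x.2 y.2)) ≤ 4 * F ^ 2 := by
    intro x
    calc _ ≤ ∑ y : Pos m n, 1 / (span x.1 y.1 : ℝ) ^ 2 * (1 / (span x.2 y.2 : ℝ) ^ 2) :=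
          Finset.sum_le_sum fun y _ =>
            half_pow_two_mul_clog_le (span_pos _ _) (span_pos _ _)
      _ = _ := hsum x (fun k => 1 / (k : ℝ) ^ 2) fun k => 1 / (k : ℝ) ^ 2
      _ ≤ (2 * F) * (2 * F) := by
          gcongr
          exacts [sum_inv_span_sq_le _, sum_inv_span_sq_le _]
      _ = 4 * F ^ 2 := by ring
  have hcard : ((Finset.univ : Finset (Pos m n)).card : ℝ) = m * n := by simp
  have h1' := Finset.sum_le_card_nsmul _ _ _ fun (x : Pos m n) (_ : x ∈ Finset.univ) => h1 x
  have h2' := Finset.sum_le_card_nsmul _ _ _ fun (x : Pos m n) (_ : x ∈ Finset.univ) => h2 x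
  rw [nsmul_eq_mul, hcard] at h1' h2'
  have hmn : (1 : ℝ) ≤ m * n := by
    rw [← hcard]
    exact_mod_cast Finset.card_pos.2 Finset.univ_nonempty
  linarith

end UpperFour

/-! ### The upper bound for 3-sided queries -/

section UpperThree

variable {m n : ℕ}

/-- The first rows down to the lower one of `x` and `y`, in the columns from that of `x` to that
of `y`. -/
def topRange (x y : Pos m n) : Finset (Pos m n) :=
  Finset.Iic (max x.1 y.1) ×ˢ Finset.uIcc x.2 y.2

/-- `topRange x y` without the column of `y`. -/
def topRangeErase (x y : Pos m n) : Finset (Pos m n) :=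
  Finset.Iic (max x.1 y.1) ×ˢ (Finset.uIcc x.2 y.2).erase y.2

/-- `x` is the maximum of the upper part of its column. -/
def IsRecord (A : Arr m n) (x : Pos m n) : Prop :=
  ∀ z ∈ Finset.Iic x.1 ×ˢ {x.2}, key A z ≤ key A x

/-- The column of `y` is the nearest one on its side of `x` obstructing `x` from being a maximum,
and it does so by its entry at `y`. -/
def BlocksColumn (A : Arr m n) (x y : Pos m n) : Prop :=
  x.2 ≠ y.2 ∧ key A x < key A y ∧ (∀ z ∈ topRange x y, key A z ≤ key A y) ∧
    ∀ z ∈ topRangeErase x y, key A z ≤ key A x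

lemma measurableSet_isRecord (x : Pos m n) : MeasurableSet {A | IsRecord A x} :=
  measurableSet_forall_key_le _ _

lemma measurableSet_blocksColumn (x y : Pos m n) : MeasurableSet {A | BlocksColumn A x y} := by
  simp only [BlocksColumn, Set.ofPred_and, ← not_le]
  exact (MeasurableSet.const _).inter ((measurableSet_key_le _ _).compl.inter
    ((measurableSet_forall_key_le _ _).inter (measurableSet_forall_key_le _ _)))

/-- The record conditions make `x` the maximum of its own column within `q`. Any remaining
obstruction lies in another column; the nearest column containing one, through its maximum within
`q`, blocks `x`. -/
lemma isArgmax_threeSided_iff {A : Arr m n} {q : Finset (Pos m n)} (hq : q ∈ threeSided m n)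
    {x : Pos m n} : IsArgmax A q x ↔ x ∈ q ∧ IsRecord A x ∧
      (∀ y ∈ q, y.2 = x.2 → x.1 < y.1 → ¬ IsRecord A y) ∧ ∀ y ∈ q, ¬ BlocksColumn A x y := by
  obtain ⟨i₀, j₁, j₂, -, rfl⟩ := hq
  set q := Finset.Iic i₀ ×ˢ Finset.Icc j₁ j₂
  have mem_q : ∀ z : Pos m n, z ∈ q ↔ z.1 ≤ i₀ ∧ z.2 ∈ Finset.Icc j₁ j₂ := fun z => by
    rw [Finset.mem_product, Finset.mem_Iic]
  have hcol : ∀ j ∈ Finset.Icc j₁ j₂, ∃ p ∈ q, p.2 = j ∧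
      ∀ z ∈ q, z.2 = j → key A z ≤ key A p := by
    intro j hj
    obtain ⟨p, hp, hmax⟩ := (q.filter fun z => z.2 = j).exists_max_image (key A)
      ⟨(⟨0, i₀.pos⟩, j), by simp [mem_q, Fin.le_def, -Finset.mem_Icc, hj]⟩
    rw [Finset.mem_filter] at hp
    exact ⟨p, hp.1, hp.2, fun z hz hzj => hmax z (Finset.mem_filter.2 ⟨hz, hzj⟩)⟩
  rw [isArgmax_iff]
  refine and_congr_right fun hx => ⟨fun h => ⟨fun z hz => ?_, fun y hy hyx hlt hrec => ?_,
    fun y hy hb => (h y hy).not_gt hb.2.1⟩, ?_⟩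
  · rw [Finset.mem_product, Finset.mem_Iic, Finset.mem_singleton] at hz
    refine h z ((mem_q z).2 ⟨hz.1.trans ((mem_q x).1 hx).1, ?_⟩)
    rw [hz.2]
    exact ((mem_q x).1 hx).2
  · have h1 := hrec x (by simp [hyx, hlt.le])
    exact hlt.ne (congrArg Prod.fst (key_injective A (h1.antisymm (h y hy))))
  rintro ⟨hrec, hlater, hblock⟩
  by_contra! hex
  obtain ⟨y₀, hy₀, hlt₀⟩ := hex
  have hsame : ∀ z ∈ q, z.2 = x.2 → key A z ≤ key A x := by
    intro z hz hzx
    obtain ⟨p, hp, hpx, hmax⟩ := hcol x.2 ((mem_q x).1 hx).2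
    refine (hmax z hz hzx).trans ?_
    by_contra! hlt
    have hxp : x.1 < p.1 := by
      by_contra! hle
      exact hlt.not_ge (hrec p (Finset.mem_product.2 ⟨Finset.mem_Iic.2 hle, by simp [hpx]⟩))
    -- The column maximum `p` within `q` would be a record below `x`.
    refine hlater p hp hpx hxp fun z hz => hmax z ?_ ?_
    · rw [Finset.mem_product, Finset.mem_Iic, Finset.mem_singleton] at hz
      refine (mem_q z).2 ⟨hz.1.trans ((mem_q p).1 hp).1, ?_⟩
      rw [hz.2]
      exact ((mem_q p).1 hp).2
    · rw [Finset.mem_product, Finset.mem_singleton] at hz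
      exact hz.2.trans hpx
  obtain ⟨y, hy, hmin⟩ := (q.filter fun y => key A x < key A y).exists_min_image
    (fun y => (Finset.uIcc x.2 y.2).card) ⟨y₀, by simp [hy₀, hlt₀]⟩
  rw [Finset.mem_filter] at hy
  obtain ⟨p, hp, hpy, hmax⟩ := hcol y.2 ((mem_q y).1 hy.1).2
  have hlt : key A x < key A p := hy.2.trans_le (hmax y hy.1 rfl)
  have hsub : topRange x p ⊆ q := by
    intro z hz
    rw [topRange, Finset.mem_product, Finset.mem_Iic] at hz
    exact (mem_q z).2 ⟨hz.1.trans (max_le ((mem_q x).1 hx).1 ((mem_q p).1 hp).1),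
      Finset.uIcc_subset_Icc ((mem_q x).1 hx).2 ((mem_q p).1 hp).2 hz.2⟩
  have herase : ∀ z ∈ topRange x p, z.2 ≠ p.2 → key A z ≤ key A x := by
    intro z hz hne
    by_contra! hz'
    have h1 := hmin z (Finset.mem_filter.2 ⟨hsub hz, hz'⟩)
    have h2 : Finset.uIcc x.2 z.2 ⊆ Finset.uIcc x.2 y.2 :=
      Finset.uIcc_subset_uIcc Finset.left_mem_uIcc (hpy ▸ (Finset.mem_product.1 hz).2)
    exact hne ((Finset.uIcc_injective_left _ (Finset.eq_of_subset_of_card_le h2 h1)).trans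
      hpy.symm)
  refine hblock p hp ⟨fun h => hlt.not_ge (hsame p hp h.symm), hlt, fun z hz => ?_, fun z hz => ?_⟩
  · by_cases hzp : z.2 = p.2
    · exact hmax z (hsub hz) (hzp.trans hpy)
    · exact (herase z hz hzp).trans hlt.le
  · rw [topRangeErase, Finset.mem_product, Finset.mem_erase] at hz
    exact herase z (Finset.mem_product.2 ⟨hz.1, hz.2.2⟩) hz.2.1

lemma measureReal_isRecord_le (x : Pos m n) :
    (randomArray m n).real {A | IsRecord A x} ≤ 1 / ((x.1 + 1 : ℕ) : ℝ) := by
  have hx : x ∈ Finset.Iic x.1 ×ˢ {x.2} := by simp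
  refine (measureReal_mono (s₂ := maxIn (Finset.Iic x.1 ×ˢ {x.2}) {x})
    (fun A (hA : IsRecord A x) => ⟨x, by simp, fun z hz => le_of_key_le (hA z hz)⟩)
    (measure_ne_top _ _)).trans
    ((measureReal_maxIn_le (Finset.singleton_subset_iff.2 hx) ⟨x, hx⟩).trans_eq ?_)
  rw [Finset.card_product, Finset.card_singleton, Finset.card_singleton, Fin.card_Iic, mul_one,
    Nat.cast_one]

/-- The two nested ranges have `M * w` and `M * (w - 1)` cells, with `M` rows and `w` columns; the
offset in `M` comes from numbering rows from 0. -/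
lemma measureReal_blocksColumn_le (x y : Pos m n) :
    (randomArray m n).real {A | BlocksColumn A x y} ≤
      2 * (1 / (((max x.1 y.1 : Fin m) + 1 : ℕ) : ℝ) ^ 2 *
        (1 / (span x.2 y.2 : ℝ) ^ 2)) := by
  by_cases hxy : x.2 = y.2
  · have : {A : Arr m n | BlocksColumn A x y} = ∅ := by ext; simp [BlocksColumn, hxy]
    rw [this, measureReal_empty]; positivity
  have hy : y ∈ topRange x y := by simp [topRange]
  have hR : topRangeErase x y ⊆ topRange x y :=
    Finset.product_subset_product_right (Finset.erase_subset _ _)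
  have hx : x ∈ topRangeErase x y := by simp [topRangeErase, hxy]
  have hsub : {A : Arr m n | BlocksColumn A x y} ⊆
      maxIn (topRange x y) {y} ∩ maxIn (topRangeErase x y) {x} := by
    rintro A ⟨-, -, h1, h2⟩
    exact ⟨⟨y, by simp, fun z hz => le_of_key_le (h1 z hz)⟩,
      x, by simp, fun z hz => le_of_key_le (h2 z hz)⟩
  refine (measureReal_mono hsub (measure_ne_top _ _)).trans
    ((measureReal_maxIn_inter_maxIn_le hy hR (by simp [topRangeErase]) hx).trans ?_)
  have hw : 0 < ((Finset.uIcc x.2 y.2).erase y.2).card :=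
    Finset.card_pos.2 ⟨x.2, Finset.mem_erase.2 ⟨hxy, Finset.left_mem_uIcc⟩⟩
  rw [topRangeErase, topRange, Finset.card_product, Finset.card_product, Fin.card_Iic,
    Finset.card_erase_of_mem Finset.right_mem_uIcc]
  rw [Finset.card_erase_of_mem Finset.right_mem_uIcc] at hw
  set M := ((max x.1 y.1 : Fin m) + 1 : ℕ)
  change 0 < span x.2 y.2 - 1 at hw
  change 1 / ((M * (span x.2 y.2 - 1) : ℕ) : ℝ) * (1 / ((M * span x.2 y.2 : ℕ) : ℝ)) ≤ _
  set w := span x.2 y.2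
  calc 1 / ((M * (w - 1) : ℕ) : ℝ) * (1 / ((M * w : ℕ) : ℝ))
      = 1 / (M : ℝ) ^ 2 * (1 / ((w - 1 : ℕ) : ℝ) * (1 / w)) := by
        push_cast; simp only [one_div, mul_inv]; ring
    _ ≤ 1 / (M : ℝ) ^ 2 * (2 * (1 / (w : ℝ) ^ 2)) :=
        mul_le_mul_of_nonneg_left (one_div_pred_mul_le (by omega)) (by positivity)
    _ = _ := by ring

lemma sum_one_div_le (hm : 2 ≤ m) :
    ∑ i : Fin m, 1 / ((i + 1 : ℕ) : ℝ) ≤ 2 * Real.logb 2 m := by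
  have h1 := harmonic_le_one_add_log m
  have h2 : ((harmonic m : ℚ) : ℝ) = ∑ i : Fin m, 1 / ((i + 1 : ℕ) : ℝ) := by
    rw [harmonic, Fin.sum_univ_eq_sum_range (fun i => 1 / ((i + 1 : ℕ) : ℝ))]
    push_cast
    simp
  have h3 : 1 ≤ Real.logb 2 m := by
    rw [Real.le_logb_iff_rpow_le one_lt_two (by positivity), Real.rpow_one]
    exact_mod_cast hm
  have h4 : Real.log m ≤ Real.logb 2 m := by
    rw [← Real.log_div_log]
    have := Real.log_two_lt_d9
    exact le_div_self (Real.log_natCast_nonneg m) (Real.log_pos one_lt_two) (by linarith)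
  linarith

lemma clog_le_two_mul_logb (hm : 2 ≤ m) : (Nat.clog 2 m : ℝ) ≤ 2 * Real.logb 2 m := by
  have h3 : 1 ≤ Real.logb 2 m := by
    rw [Real.le_logb_iff_rpow_le one_lt_two (by positivity), Real.rpow_one]
    exact_mod_cast hm
  obtain ⟨k, hk⟩ := Nat.exists_eq_add_of_le' (Nat.clog_pos one_lt_two hm)
  have h1 : 2 ^ k < m := by
    rw [← Nat.lt_clog_iff_pow_lt one_lt_two]; omega
  have h2 : (k : ℝ) ≤ Real.logb 2 m := by
    rw [Real.le_logb_iff_rpow_le one_lt_two (by positivity), Real.rpow_natCast]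
    exact_mod_cast h1.le
  rw [hk]; push_cast; linarith

/-- For each `i` there are `i + 1` indices `i' ≤ i`, contributing `1 / (i + 1)` together; by
symmetry the bound is twice their sum, with the diagonal counted twice. -/
lemma sum_one_div_max_sq_le :
    ∑ i : Fin m, ∑ i' : Fin m, 1 / (((max i i' : Fin m) + 1 : ℕ) : ℝ) ^ 2 ≤
      2 * ∑ i : Fin m, 1 / ((i + 1 : ℕ) : ℝ) := by
  have hrow : ∀ i : Fin m, ∑ i' : Fin m, (if i' ≤ i then 1 / ((i + 1 : ℕ) : ℝ) ^ 2 else 0) =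
      1 / ((i + 1 : ℕ) : ℝ) := by
    intro i
    rw [← Finset.sum_filter, Finset.sum_const, Finset.filter_ge_eq_Iic, Fin.card_Iic, nsmul_eq_mul]
    field_simp
  calc _ ≤ ∑ i : Fin m, ∑ i' : Fin m, ((if i' ≤ i then 1 / ((i + 1 : ℕ) : ℝ) ^ 2 else 0) +
        if i ≤ i' then 1 / ((i' + 1 : ℕ) : ℝ) ^ 2 else 0) := by
        refine Finset.sum_le_sum fun i _ => Finset.sum_le_sum fun i' _ => ?_
        rcases le_total i i' with h | h
        · rw [max_eq_right h, if_pos h]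
          exact le_add_of_nonneg_left (by split_ifs <;> positivity)
        · rw [max_eq_left h, if_pos h]
          exact le_add_of_nonneg_right (by split_ifs <;> positivity)
    _ = _ := by
        simp only [Finset.sum_add_distrib]
        rw [Finset.sum_comm (f := fun i i' : Fin m =>
          if i ≤ i' then 1 / ((i' + 1 : ℕ) : ℝ) ^ 2 else 0)]
        simp only [hrow]
        ring

lemma sum_sum_pos_mul (f : Fin m → Fin m → ℝ) (g : Fin n → Fin n → ℝ) :
    ∑ x : Pos m n, ∑ y : Pos m n, f x.1 y.1 * g x.2 y.2 =
      (∑ i, ∑ i', f i i') * ∑ j, ∑ j', g j j' := by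
  simp only [sum_pos_mul]
  exact sum_pos_mul (fun i => ∑ i', f i i') fun j => ∑ j', g j j'

lemma expectedEffectiveEntropy_threeSided_le (kind : CodeKind) [Nonempty (Pos m n)] (hm : 2 ≤ m) :
    expectedEffectiveEntropy kind (threeSided m n) ≤ ENNReal.ofReal
      ((132 * sumInvSq + 64 * sumClogInvSq + 12) * (n * Real.logb 2 m ^ 2)) := by
  set F := sumInvSq
  set G := sumClogInvSq
  set l := Real.logb 2 m
  set c := Nat.clog 2 m
  set H := ∑ i : Fin m, 1 / ((i + 1 : ℕ) : ℝ)
  have hF : 0 ≤ F := sumInvSq_nonneg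
  have hG : 0 ≤ G := sumClogInvSq_nonneg
  have hH0 : 0 ≤ H := Finset.sum_nonneg fun _ _ => by positivity
  have hH : H ≤ 2 * l := sum_one_div_le hm
  have hc : (c : ℝ) ≤ 2 * l := clog_le_two_mul_logb hm
  have hl : 1 ≤ l := by
    rw [Real.le_logb_iff_rpow_le one_lt_two (by positivity), Real.rpow_one]
    exact_mod_cast hm
  have hm0 : (m : ℝ) ≠ 0 := by positivity
  have hn : (1 : ℝ) ≤ n := by
    obtain ⟨x⟩ := ‹Nonempty (Pos m n)›
    exact_mod_cast x.2.pos
  have hV : ∑ j : Fin n, ∑ j' : Fin n, 1 / (span j j' : ℝ) ^ 2 ≤ n * (2 * F) := by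
    have := Finset.sum_le_card_nsmul Finset.univ _ _ fun (j : Fin n) _ => sum_inv_span_sq_le j
    simpa using this
  have hVc : ∑ j : Fin n, ∑ j' : Fin n, (Nat.clog 2 (span j j') : ℝ) / (span j j' : ℝ) ^ 2 ≤ n * (2 * G) := by
    have := Finset.sum_le_card_nsmul Finset.univ _ _ fun (j : Fin n) _ => sum_clog_span_le j
    simpa using this
  have hQ : ∀ q ∈ threeSided m n, q.Nonempty := by
    rintro q ⟨i, j₁, j₂, hj, rfl⟩
    exact ⟨(i, j₁), by simp [hj]⟩
  refine (expectedEffectiveEntropy_le kind hQ (I := Pos m n ⊕ Pos m n × Pos m n)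
    (Sum.elim (fun x => {A | IsRecord A x}) fun e => {A | BlocksColumn A e.1 e.2})
    (by rintro (x | e); exacts [measurableSet_isRecord _, measurableSet_blocksColumn _ _])
    -- Rows are priced uniformly at `c` bits each, since `2 ^ (-c) ≤ 1 / m` cancels the number of
    -- rows; only the column distance is priced by its size.
    (Sum.elim (fun _ => c) fun e => 2 * c + 2 * Nat.clog 2 (span e.1.2 e.2.2)) ?_).trans
    (ENNReal.ofReal_le_ofReal ?_)
  · intro A B hAB q hq x
    rw [isArgmax_threeSided_iff hq, isArgmax_threeSided_iff hq]
    exact fun hx => ⟨hx.1, (hAB (.inl x)).1 hx.2.1,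
      fun y hy hyx hlt hrec => hx.2.2.1 y hy hyx hlt ((hAB (.inl y)).2 hrec),
      fun y hy hb => hx.2.2.2 y hy ((hAB (.inr (x, y))).2 hb)⟩
  simp only [Fintype.sum_sum_type, Sum.elim_inl, Sum.elim_inr]
  rw [Fintype.sum_prod_type' (fun x y : Pos m n =>
      ((2 * c + 2 * Nat.clog 2 (span x.2 y.2) : ℕ) : ℝ) *
      (randomArray m n).real {A | BlocksColumn A x y}),
    Fintype.sum_prod_type' (fun x y : Pos m n =>
      (1 / 2 : ℝ) ^ (2 * c + 2 * Nat.clog 2 (span x.2 y.2)))]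
  have h1 : ∑ x : Pos m n, (c : ℝ) * (randomArray m n).real {A | IsRecord A x} ≤
      n * (4 * l ^ 2) := by
    calc _ ≤ ∑ x : Pos m n, (1 / ((x.1 + 1 : ℕ) : ℝ)) * c := by
          refine Finset.sum_le_sum fun x _ => ?_
          rw [mul_comm]
          gcongr
          exact measureReal_isRecord_le x
      _ = H * (n * c) := by
          rw [sum_pos_mul (fun i : Fin m => 1 / ((i + 1 : ℕ) : ℝ)) fun _ : Fin n => (c : ℝ)]
          simp [H]
      _ ≤ (2 * l) * (n * (2 * l)) := by gcongr
      _ = n * (4 * l ^ 2) := by ring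
  have h2 : ∑ x : Pos m n, ∑ y : Pos m n, ((2 * c + 2 * Nat.clog 2 (span x.2 y.2) : ℕ) : ℝ) *
      (randomArray m n).real {A | BlocksColumn A x y} ≤ n * (l ^ 2 * (64 * F + 32 * G)) := by
    calc _ ≤ ∑ x : Pos m n, ∑ y : Pos m n, (1 / (((max x.1 y.1 : Fin m) + 1 : ℕ) : ℝ) ^ 2) *
          (4 * c * (1 / (span x.2 y.2 : ℝ) ^ 2) +
            4 * ((Nat.clog 2 (span x.2 y.2) : ℝ) / (span x.2 y.2 : ℝ) ^ 2)) := by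
          refine Finset.sum_le_sum fun x _ => Finset.sum_le_sum fun y _ => ?_
          refine (mul_le_mul_of_nonneg_left (measureReal_blocksColumn_le x y)
            (by positivity)).trans_eq ?_
          push_cast
          ring
      _ = (∑ i : Fin m, ∑ i' : Fin m, 1 / (((max i i' : Fin m) + 1 : ℕ) : ℝ) ^ 2) *
          (4 * c * (∑ j : Fin n, ∑ j' : Fin n, 1 / (span j j' : ℝ) ^ 2) +
            4 * ∑ j : Fin n, ∑ j' : Fin n, (Nat.clog 2 (span j j') : ℝ) / (span j j' : ℝ) ^ 2) := by
          rw [sum_sum_pos_mul (fun i i' : Fin m => 1 / (((max i i' : Fin m) + 1 : ℕ) : ℝ) ^ 2)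
            fun j j' : Fin n => 4 * c * (1 / (span j j' : ℝ) ^ 2) +
              4 * ((Nat.clog 2 (span j j') : ℝ) / (span j j' : ℝ) ^ 2)]
          simp only [Finset.sum_add_distrib, ← Finset.mul_sum]
      _ ≤ (2 * (2 * l)) * (4 * (2 * l) * (n * (2 * F)) + 4 * (n * (2 * G))) := by
          gcongr
          exact sum_one_div_max_sq_le.trans (by linarith)
      _ = n * (l * l * (64 * F) + l * (32 * G)) := by ring
      _ ≤ n * (l * l * (64 * F) + l * l * (32 * G)) := by
          gcongr
          nlinarith
      _ = n * (l ^ 2 * (64 * F + 32 * G)) := by ring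
  have h3 : ∑ _x : Pos m n, (1 / 2 : ℝ) ^ c ≤ n := by
    calc _ ≤ ∑ _x : Pos m n, 1 / (m : ℝ) :=
          Finset.sum_le_sum fun _ _ => half_pow_clog_le (by omega)
      _ = n := by
          simp only [Finset.sum_const, Finset.card_univ, Fintype.card_prod, Fintype.card_fin,
            nsmul_eq_mul, Nat.cast_mul]
          field_simp
  have h4 : ∑ x : Pos m n, ∑ y : Pos m n,
      (1 / 2 : ℝ) ^ (2 * c + 2 * Nat.clog 2 (span x.2 y.2)) ≤ n * (2 * F) := by
    calc _ ≤ ∑ x : Pos m n, ∑ y : Pos m n, 1 / (m : ℝ) ^ 2 * (1 / (span x.2 y.2 : ℝ) ^ 2) :=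
          Finset.sum_le_sum fun x _ => Finset.sum_le_sum fun y _ =>
            half_pow_two_mul_clog_le (by omega) (span_pos _ _)
      _ = ∑ j : Fin n, ∑ j' : Fin n, 1 / (span j j' : ℝ) ^ 2 := by
          rw [sum_sum_pos_mul (fun _ _ : Fin m => 1 / (m : ℝ) ^ 2)
            fun j j' : Fin n => 1 / (span j j' : ℝ) ^ 2]
          simp only [Finset.sum_const, Finset.card_univ, Fintype.card_fin, nsmul_eq_mul]
          rw [show (m : ℝ) * (m * (1 / (m : ℝ) ^ 2)) = 1 by field_simp, one_mul]
      _ ≤ _ := hV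
  have hl2 : 1 ≤ l ^ 2 := one_le_pow₀ hl
  -- The terms without a logarithm, including the additive 2, total at most `n * (4 * F + 4)` and
  -- are absorbed using `l ≥ 1`.
  have h5 : (n : ℝ) * (4 * F + 4) ≤ n * (4 * F + 4) * l ^ 2 :=
    le_mul_of_one_le_right (by positivity) hl2
  nlinarith

end UpperThree

end RMQ2D

theorem mainTheorem1 :
    (∃ c C : ℝ, 0 < c ∧ 0 < C ∧
      ∀ (kind : RMQ2D.CodeKind) (m n : ℕ), 2 ≤ m → m ≤ n →
        ENNReal.ofReal (c * (n * m)) ≤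
          RMQ2D.expectedEffectiveEntropy kind (RMQ2D.fourSided m n) ∧
        RMQ2D.expectedEffectiveEntropy kind (RMQ2D.fourSided m n) ≤
          ENNReal.ofReal (C * (n * m))) ∧
    (∃ c C : ℝ, 0 < c ∧ 0 < C ∧
      ∀ (kind : RMQ2D.CodeKind) (m n : ℕ), 2 ≤ m → m ≤ n →
        ENNReal.ofReal (c * (n * Real.logb 2 m ^ 2)) ≤
          RMQ2D.expectedEffectiveEntropy kind (RMQ2D.threeSided m n) ∧
        RMQ2D.expectedEffectiveEntropy kind (RMQ2D.threeSided m n) ≤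
          ENNReal.ofReal (C * (n * Real.logb 2 m ^ 2))) := by
  have hF := RMQ2D.sumInvSq_nonneg
  have hG := RMQ2D.sumClogInvSq_nonneg
  have hne : ∀ m n : ℕ, 2 ≤ m → m ≤ n → Nonempty (RMQ2D.Pos m n) := fun m n hm hn =>
    ⟨⟨0, by omega⟩, ⟨0, by omega⟩⟩
  refine ⟨⟨1 / 24, 64 * (RMQ2D.sumInvSq * RMQ2D.sumClogInvSq) + 8 * RMQ2D.sumInvSq ^ 2 + 2,
    by norm_num, by positivity, fun kind m n hm hn => ?_⟩,
    ⟨1 / 64, 132 * RMQ2D.sumInvSq + 64 * RMQ2D.sumClogInvSq + 12,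
    by norm_num, by positivity, fun kind m n hm hn => ?_⟩⟩
  · have := hne m n hm hn
    exact ⟨RMQ2D.le_expectedEffectiveEntropy_fourSided kind hm (hm.trans hn),
      RMQ2D.expectedEffectiveEntropy_fourSided_le kind⟩
  · have := hne m n hm hn
    exact ⟨RMQ2D.le_expectedEffectiveEntropy_threeSided kind hm (by omega),
      RMQ2D.expectedEffectiveEntropy_threeSided_le kind hm⟩
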